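/- **Model.** A base station (BS) is at the origin of the plane. $K\ge 2$ grant-free (GF) users are placed independently and uniformly in the disc of radius $D_F>0$ (binomial point process), and one grant-based (GB) user is placed uniformly in the ring $\{D_0\le |z|\le D_1\}$, $0<D_0<D_1$. Each user has a fading coefficient $\zeta\sim\mathcal{CN}(0,1)$, all positions and fading coefficients are mutually independent, and the channel of a user at distance $r$ is $\zeta/\sqrt{1+r^{\alpha}}$, with path loss exponent $\alpha>0$. Let $h_1,\dots,h_K$ be the GF channels, labelled so that $|h_1|^2\le\dots\le|h_K|^2$, and $g$ the GB channel. The noise variance is $1$, the transmit powers are $P_F,P_B>0$, the target rates are $R_F,R_B>0$, and $\gamma_F=2^{R_F}-1$, $\gamma_B=2^{R_B}-1$, $\alpha_F=\gamma_F/P_F$, $\alpha_B=\gamma_B/P_B$, $\alpha_1=\alpha_B(\gamma_F+1)$, $\alpha_2=\frac{\alpha_B(\gamma_F+1)}{1-\gamma_B\gamma_F}$. **Scheme (BU-SGF with HSIC).** With $\tau_0=\max\{0,P_B|g|^2/\gamma_B-1\}$, the $i$-th GF user has achievable rate $R_i^{fs}=\log_2\bigl(1+\frac{P_F|h_i|^2}{P_B|g|^2+1}\bigr)$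 if $P_F|h_i|^2>\tau_0$, and $R_i^{ss}=\log_2(1+P_F|h_i|^2)$ otherwise. A GF user with the maximal achievable rate is admitted; $\mathcal P_{BU}$ is the probability that its rate is less than $R_F$. **Distribution functions.** Let $$F_F(x)=\frac{2}{D_F^2}\int_0^{D_F}\bigl[1-e^{-(1+r^\alpha)x}\bigr]r\,dr,\qquad F_B(y)=\frac{2}{D_1^2-D_0^2}\int_{D_0}^{D_1}\bigl[1-e^{-(1+r^\alpha)y}\bigr]r\,dr,\qquad f_B=F_B' .$$ For integers $L,N\ge1$ their Gaussian–Chebyshev approximations are $$F_F^{L}(x)=\tfrac12\sum_{l=1}^L\Psi_l(1-e^{-\mu_l x}),\quad F_B^{N}(y)=\tfrac1{D_1+D_0}\sum_{n=1}^N\Phi_n(1-e^{-c_ny}),\quad f_B^{N}(y)=\tfrac1{D_1+D_0}\sum_{n=1}^N\Phi_nc_ne^{-c_ny},$$ where, with $t_{n,i}=\cos\frac{(2i-1)\pi}{2n}$: $\Psi_l=\frac{\pi}{L}\sqrt{1-t_{L,l}^2}\,(1+t_{L,l})$, $\mu_l=1+\bigl(\frac{D_F}{2}+\frac{D_F}{2}t_{L,l}\bigr)^\alpha$,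 $\phi_n=\frac{D_1+D_0}{2}+\frac{D_1-D_0}{2}t_{N,n}$, $\Phi_n=\frac{\pi}{N}\sqrt{1-t_{N,n}^2}\,\phi_n$, $c_n=1+\phi_n^\alpha$; put also $\Psi_0=-2$, $\mu_0=0$. **Integrals.** For functions $F,G,f$ write $u(w)=F(\alpha_FP_Bw+\alpha_F)$, $v(w)=F\bigl(\frac{\alpha_B^{-1}w-1}{P_F}\bigr)$ and, for $0\le k\le K$, $$j_{1;k}=f\,v^k(u-v)^{K-k},\qquad j_{2;k}=f\,F(\alpha_F)^k(u-v)^{K-k},\qquad j_3=f\,u^K,$$ $$I_{1;k}=\int_{\alpha_B}^{\alpha_1}j_{1;k},\quad I_{2;k}=\int_{\alpha_1}^{\alpha_2}j_{2;k},\quad I_{2;k}^{\infty}=\int_{\alpha_1}^{\infty}j_{2;k},\quad I_3=\int_0^{\alpha_B}j_3,\quad I_4=[1-G(\alpha_2)]F(\alpha_F)^K .$$ For $a<b$ let $Q_n[j;a,b]=\frac{b-a}{2}\sum_{i=1}^n\frac{\pi}{n}\sqrt{1-t_{n,i}^2}\;j\bigl(\tfrac{(b-a)t_{n,i}+(b+a)}{2}\bigr)$.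 The integrals without further mark are taken at the exact functions $(F,G,f)=(F_F,F_B,f_B)$. Let $G_{1;k}=Q_I[j_{1;k};\alpha_B,\alpha_1]$, $G_{2;k}=Q_J[j_{2;k};\alpha_1,\alpha_2]$, $G_3=Q_M[j_3;0,\alpha_B]$ and $\hat I_4$ (the quantity $I_4$) be evaluated at $(F,G,f)=(F_F^L,F_B^N,f_B^N)$, and $$\begin{aligned}H_{2;k}=&\Bigl(-\frac12\Bigr)^{K-k}\frac{F_F^L(\alpha_F)^k}{D_0+D_1}\sum_{n=1}^N\Phi_nc_n\sum_{m=0}^{K-k}\binom{K-k}{m}(-1)^m\sum_{p_0+\dots+p_L=K-k-m}\binom{K-k-m}{p_0,\dots,p_L}\sum_{q_0+\dots+q_L=m}\binom{m}{q_0,\dots,q_L}\\&\times\Bigl(\prod_{l=0}^L\Psi_l^{p_l+q_l}\Bigr)e^{\sum_{l}(q_l\mu_lP_F^{-1}-p_l\mu_l\alpha_F)}\;\frac{e^{-S\alpha_1}}{S},\qquad S=\sum_{l=0}^L\bigl(p_l\mu_l\alpha_FP_B+q_l\mu_lP_F^{-1}\alpha_B^{-1}\bigr)+c_n .\end{aligned}$$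 Let $\bar\eta_k=\frac{K!}{k!(K-k)!}$. **Theorem.** Let $K\ge2$. On $[0,\infty)$, $F_F$ is the CDF of the gain of each (unordered) GF user, and $F_B$ is the CDF of $|g|^2$, with derivative $f_B(y)=\frac{2}{D_1^2-D_0^2}\int_{D_0}^{D_1}(1+r^\alpha)e^{-(1+r^\alpha)y}r\,dr$. Moreover $$\mathcal P_{BU}=\sum_{k=0}^K\mathbb P\bigl\{E_k,\ R_i^{ss}<R_F\ (1\le i\le k),\ R_i^{fs}<R_F\ (k<i\le K)\bigr\},$$ where $E_k$ is the event that exactly $k$ of the GF users have $P_F|h_i|^2\le\tau_0$. 1. If $\gamma_B\gamma_F<1$, then exactly $$\mathcal P_{BU}=\sum_{k=0}^K\bar\eta_kI_{1;k}+\sum_{k=0}^K\bar\eta_kI_{2;k}+I_3+I_4,$$ and approximately $$\mathcal P_{BU}\approx\sum_{k=0}^K\bar\eta_kG_{1;k}+\sum_{k=0}^K\bar\eta_kG_{2;k}+G_3+\hat I_4 .$$ 2. If $\gamma_B\gamma_F\ge1$, then the functions $j_{2;k}$ are integrable on $(\alpha_1,\infty)$ and exactly $$\mathcal P_{BU}=\sum_{k=0}^K\bar\eta_kI_{1;k}+\sum_{k=0}^K\bar\eta_kI^\infty_{2;k}+I_3,$$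 and approximately $$\mathcal P_{BU}\approx\sum_{k=0}^K\bar\eta_kG_{1;k}+\sum_{k=0}^K\bar\eta_kH_{2;k}+G_3 .$$ Here, for all $L,N\ge1$, the function $j_{2;k}$ taken at $(F,f)=(F_F^L,f_B^N)$ is integrable on $(\alpha_1,\infty)$ and its integral is exactly $H_{2;k}$. The sign $\approx$ means that the right-hand side converges to $\mathcal P_{BU}$ as all its quadrature orders among $I,J,M,L,N$ tend to infinity jointly (in any manner). In the same sense each term converges to the quantity that it approximates: $G_{1;k}\to I_{1;k}$ and $G_3\to I_3$ in both cases, $G_{2;k}\to I_{2;k}$ and $\hat I_4\to I_4$ if $\gamma_B\gamma_F<1$, and $H_{2;k}\to I_{2;k}^{\infty}$ if $\gamma_B\gamma_F\ge1$ $(0\le k\le K)$. -/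

import Mathlib

open MeasureTheory ProbabilityTheory Filter Topology

noncomputable section

/-- The law `CN(0,1)` of a standard circularly symmetric complex Gaussian variable, given by its
density `exp (-|z|²) / π` with respect to Lebesgue measure on the complex plane. -/
def stdComplexGaussian : Measure ℂ :=
  volume.withDensity fun z => ENNReal.ofReal (Real.exp (-‖z‖ ^ 2) / Real.pi)

/-- The uniform law on the disc of radius `R` around the base station (placed at the origin). -/
def uniformDisc (R : ℝ) : Measure ℂ :=
  cond volume (Metric.closedBall (0 : ℂ) R)

/-- The uniform law on the ring with inner radius `R₀` and outer radius `R₁`. -/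
def uniformRing (R₀ R₁ : ℝ) : Measure ℂ :=
  cond volume {z : ℂ | R₀ ≤ ‖z‖ ∧ ‖z‖ ≤ R₁}

/-- Chebyshev node `cos ((2 i - 1) π / (2 n))` -/
def chebNode (n i : ℕ) : ℝ := Real.cos ((2 * (i : ℝ) - 1) * Real.pi / (2 * (n : ℝ)))

/-- The numerical data of the system: number `K` of grant-free (GF) users, radius `DF` of their
disc, radii `D0`, `D1` of the ring of the grant-based (GB) user, path loss exponent `a`, transmit
powers `PF`, `PB` and target rates `RF`, `RB`. The noise variance is `1`. -/
structure SGFParams where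
  K : ℕ
  DF : ℝ
  D0 : ℝ
  D1 : ℝ
  a : ℝ
  PF : ℝ
  PB : ℝ
  RF : ℝ
  RB : ℝ

namespace SGFParams

variable (P : SGFParams)

/-- target SINR of the admitted GF user -/
def gamF : ℝ := (2 : ℝ) ^ P.RF - 1

/-- target SINR of the GB user -/
def gamB : ℝ := (2 : ℝ) ^ P.RB - 1

def alF : ℝ := P.gamF / P.PF

def alB : ℝ := P.gamB / P.PB

def al1 : ℝ := P.alB * (P.gamF + 1)

def al2 : ℝ := P.alB * (P.gamF + 1) / (1 - P.gamB * P.gamF)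

/-! ### The scheme

Users are indexed by `Option (Fin P.K)`: `some k` is the `k`-th GF user (in no particular order),
`none` is the GB user. The randomness consists of the positions `x u` and the fading coefficients
`ζ u` of all users `u`. -/

section Scheme

variable {Ω : Type*} (x ζ : Option (Fin P.K) → Ω → ℂ)

/-- channel coefficient `ζ / √(1 + r ^ a)`, where `r` is the distance to the base station -/
def channel (u : Option (Fin P.K)) (ω : Ω) : ℂ :=
  ζ u ω / ((Real.sqrt (1 + ‖x u ω‖ ^ P.a) : ℝ) : ℂ)

/-- channel gain: squared modulus of the channel coefficient -/
def gain (u : Option (Fin P.K)) (ω : Ω) : ℝ := ‖P.channel x ζ u ω‖ ^ 2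

/-- the decoding threshold `τ₀` broadcast by the base station -/
def tau0 (ω : Ω) : ℝ := max 0 (P.PB * P.gain x ζ none ω / P.gamB - 1)

/-- rate achieved at gain `h` when decoded at the first stage, the GB signal being interference -/
def rateFS (h : ℝ) (ω : Ω) : ℝ :=
  Real.logb 2 (1 + P.PF * h / (P.PB * P.gain x ζ none ω + 1))

/-- rate achieved at gain `h` when decoded at the second stage, the GB signal being removed -/
def rateSS (h : ℝ) : ℝ := Real.logb 2 (1 + P.PF * h)

/-- achievable rate of the `k`-th GF user with HSIC decoding -/
def rate (k : Fin P.K) (ω : Ω) : ℝ :=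
  if P.tau0 x ζ ω < P.PF * P.gain x ζ (some k) ω
  then P.rateFS x ζ (P.gain x ζ (some k) ω) ω
  else P.rateSS (P.gain x ζ (some k) ω)

/-- rate of the admitted user, i.e. of a GF user with the maximal achievable rate -/
def admittedRate (ω : Ω) : ℝ := ⨆ k : Fin P.K, P.rate x ζ k ω

/-- outage probability of the admitted GF user -/
def outageProb [MeasurableSpace Ω] (ν : Measure Ω) : ℝ :=
  ν.real {ω | P.admittedRate x ζ ω < P.RF}

/-- the GF channel gains in increasing order -/
def orderedGain (ω : Ω) (i : Fin P.K) : ℝ :=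
  P.gain x ζ (some (Tuple.sort (fun k => P.gain x ζ (some k) ω) i)) ω

/-- number of GF users whose received power does not exceed the threshold -/
def numBelow (ω : Ω) : ℕ :=
  (Finset.univ.filter fun k : Fin P.K => P.PF * P.gain x ζ (some k) ω ≤ P.tau0 x ζ ω).card

/-- Exactly `k` received powers are at most the threshold, the `k` users with the smallest gains
have second-stage rate below target, the others first-stage rate below target. -/
def outageEvent (k : ℕ) : Set Ω :=
  {ω | P.numBelow x ζ ω = k ∧
    (∀ i : Fin P.K, (i : ℕ) < k → P.rateSS (P.orderedGain x ζ ω i) < P.RF) ∧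
    (∀ i : Fin P.K, k ≤ (i : ℕ) → P.rateFS x ζ (P.orderedGain x ζ ω i) ω < P.RF)}

end Scheme

/-! ### Distribution functions of the unordered gains -/

/-- CDF of the channel gain of a GF user -/
def FF (y : ℝ) : ℝ :=
  2 / P.DF ^ 2 * ∫ r in (0 : ℝ)..P.DF, (1 - Real.exp (-(1 + r ^ P.a) * y)) * r

/-- CDF of the channel gain of the GB user -/
def FB (y : ℝ) : ℝ :=
  2 / (P.D1 ^ 2 - P.D0 ^ 2) *
    ∫ r in P.D0..P.D1, (1 - Real.exp (-(1 + r ^ P.a) * y)) * r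

/-- density of the channel gain of the GB user -/
def fB (y : ℝ) : ℝ :=
  2 / (P.D1 ^ 2 - P.D0 ^ 2) *
    ∫ r in P.D0..P.D1, (1 + r ^ P.a) * Real.exp (-(1 + r ^ P.a) * y) * r

/-! ### Their Gaussian–Chebyshev approximations -/

/-- `Ψ_l` for `1 ≤ l ≤ L`, extended by `Ψ_0 = -2` -/
def Psi (L l : ℕ) : ℝ :=
  if l = 0 then -2
  else Real.pi / L * Real.sqrt (1 - chebNode L l ^ 2) * (1 + chebNode L l)

/-- `μ_l` for `1 ≤ l ≤ L`, extended by `μ_0 = 0` -/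
def mu (L l : ℕ) : ℝ :=
  if l = 0 then 0 else 1 + (P.DF / 2 + P.DF / 2 * chebNode L l) ^ P.a

/-- the node `φ_n`, a point of `[D0, D1]` -/
def phi (N n : ℕ) : ℝ := (P.D1 + P.D0) / 2 + (P.D1 - P.D0) / 2 * chebNode N n

/-- the weight `Φ_n` -/
def Phi (N n : ℕ) : ℝ := Real.pi / N * Real.sqrt (1 - chebNode N n ^ 2) * P.phi N n

def c (N n : ℕ) : ℝ := 1 + P.phi N n ^ P.a

def FFapprox (L : ℕ) (y : ℝ) : ℝ :=
  1 / 2 * ∑ l ∈ Finset.Icc 1 L, Psi L l * (1 - Real.exp (-P.mu L l * y))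

def FBapprox (N : ℕ) (y : ℝ) : ℝ :=
  1 / (P.D1 + P.D0) * ∑ n ∈ Finset.Icc 1 N, P.Phi N n * (1 - Real.exp (-P.c N n * y))

def fBapprox (N : ℕ) (y : ℝ) : ℝ :=
  1 / (P.D1 + P.D0) * ∑ n ∈ Finset.Icc 1 N, P.Phi N n * P.c N n * Real.exp (-P.c N n * y)

/-! ### The integrals

`F`, `G` and `f` stand for the CDF of a GF gain and the CDF and density of the GB gain, or for
approximations of them. -/

def integrand1 (F f : ℝ → ℝ) (k : ℕ) (w : ℝ) : ℝ :=
  f w * F ((P.alB⁻¹ * w - 1) / P.PF) ^ k *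
    (F (P.alF * P.PB * w + P.alF) - F ((P.alB⁻¹ * w - 1) / P.PF)) ^ (P.K - k)

def integrand2 (F f : ℝ → ℝ) (k : ℕ) (w : ℝ) : ℝ :=
  f w * F P.alF ^ k *
    (F (P.alF * P.PB * w + P.alF) - F ((P.alB⁻¹ * w - 1) / P.PF)) ^ (P.K - k)

def integrand3 (F f : ℝ → ℝ) (w : ℝ) : ℝ := f w * F (P.alF * P.PB * w + P.alF) ^ P.K

def I1 (F f : ℝ → ℝ) (k : ℕ) : ℝ := ∫ w in P.alB..P.al1, P.integrand1 F f k w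

def I2 (F f : ℝ → ℝ) (k : ℕ) : ℝ := ∫ w in P.al1..P.al2, P.integrand2 F f k w

/-- `I2` with `α₂` replaced by `∞` -/
def I2inf (F f : ℝ → ℝ) (k : ℕ) : ℝ := ∫ w in Set.Ioi P.al1, P.integrand2 F f k w

def I3 (F f : ℝ → ℝ) : ℝ := ∫ w in (0 : ℝ)..P.alB, P.integrand3 F f w

def I4 (F G : ℝ → ℝ) : ℝ := (1 - G P.al2) * F P.alF ^ P.K

/-! ### Their Gaussian–Chebyshev approximations -/

def G1 (F f : ℝ → ℝ) (n k : ℕ) : ℝ :=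
  (P.al1 - P.alB) / 2 * ∑ i ∈ Finset.Icc 1 n, Real.pi / n * Real.sqrt (1 - chebNode n i ^ 2) *
    P.integrand1 F f k (((P.al1 - P.alB) * chebNode n i + (P.al1 + P.alB)) / 2)

def G2 (F f : ℝ → ℝ) (n k : ℕ) : ℝ :=
  (P.al2 - P.al1) / 2 * ∑ j ∈ Finset.Icc 1 n, Real.pi / n * Real.sqrt (1 - chebNode n j ^ 2) *
    P.integrand2 F f k (((P.al2 - P.al1) * chebNode n j + (P.al2 + P.al1)) / 2)

def G3 (F f : ℝ → ℝ) (n : ℕ) : ℝ :=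
  P.alB / 2 * ∑ m ∈ Finset.Icc 1 n, Real.pi / n * Real.sqrt (1 - chebNode n m ^ 2) *
    P.integrand3 F f ((chebNode n m + 1) * P.alB / 2)

/-- The closed form `H_{2;k}`. The inner sums run over all `(p_0,…,p_L)` with sum `K - k - m` and
all `(q_0,…,q_L)` with sum `m`. -/
def H2 (L N k : ℕ) : ℝ :=
  (-1 / 2) ^ (P.K - k) * (P.FFapprox L P.alF ^ k / (P.D0 + P.D1)) *
  ∑ n ∈ Finset.Icc 1 N, P.Phi N n * P.c N n *
  ∑ m ∈ Finset.range (P.K - k + 1), ((P.K - k).choose m : ℝ) * (-1) ^ m *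
  ∑ p ∈ (Finset.range (L + 1)).piAntidiag (P.K - k - m),
    (Nat.multinomial (Finset.range (L + 1)) p : ℝ) *
  ∑ q ∈ (Finset.range (L + 1)).piAntidiag m,
    (Nat.multinomial (Finset.range (L + 1)) q : ℝ) *
    (∏ l ∈ Finset.range (L + 1), Psi L l ^ (p l + q l)) *
    Real.exp (∑ l ∈ Finset.range (L + 1),
      ((q l : ℝ) * P.mu L l * P.PF⁻¹ - (p l : ℝ) * P.mu L l * P.alF)) *
    (Real.exp (-((∑ l ∈ Finset.range (L + 1), ((p l : ℝ) * P.mu L l * P.alF * P.PB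
        + (q l : ℝ) * P.mu L l * P.PF⁻¹ * P.alB⁻¹)) + P.c N n) * P.al1) /
      ((∑ l ∈ Finset.range (L + 1), ((p l : ℝ) * P.mu L l * P.alF * P.PB
        + (q l : ℝ) * P.mu L l * P.PF⁻¹ * P.alB⁻¹)) + P.c N n))

/-- `∑_{k=0}^{K} K!/(k!(K-k)!) u_k` -/
def binomSum (u : ℕ → ℝ) : ℝ := ∑ k ∈ Finset.range (P.K + 1), (P.K.choose k : ℝ) * u k

/-- the approximation of the outage probability when `γ_B γ_F < 1` -/
def approxLT (I J M L N : ℕ) : ℝ :=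
  P.binomSum (P.G1 (P.FFapprox L) (P.fBapprox N) I) +
  P.binomSum (P.G2 (P.FFapprox L) (P.fBapprox N) J) +
  P.G3 (P.FFapprox L) (P.fBapprox N) M +
  P.I4 (P.FFapprox L) (P.FBapprox N)

/-- the approximation of the outage probability when `1 ≤ γ_B γ_F` -/
def approxGE (I M L N : ℕ) : ℝ :=
  P.binomSum (P.G1 (P.FFapprox L) (P.fBapprox N) I) +
  P.binomSum (P.H2 L N) +
  P.G3 (P.FFapprox L) (P.fBapprox N) M

end SGFParams

end

/-! Exact formulas. The maximal rate is below target iff every GF user's rate is. Given the GB gain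
`w`, the GF gains are i.i.d. with CDF `FF`, so the outage probability is the integral over `(0, ∞)`
of `fB w * q w ^ K`, with `q w` the conditional outage probability of one user. With `u`, `v` the
arguments of `FF` in the integrands, a user of gain `y` decoded first fails iff `y < u`, and one
decoded second fails iff `y < alF`; for `w > alB` the stages are separated by `y = v`. Up to `al1`,
where `v = alF`, every second-stage user fails and `q = FF u`. Beyond it, failure means `y < alF` or
`v < y < u`, so `q = FF alF + (FF u - FF v)` as long as `v ≤ u`, and `q = FF alF` otherwise. The
condition `v ≤ u` is linear in `w` with coefficient `1 - gamB * gamF`: it ends at `al2` if the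
product is below one and never fails otherwise. The sums over `k` are the binomial expansions of `q
^ K`. The carriers are `measureReal_forall_mem`, `userOutageProb_of_lt_al1`, `userOutageProb_of_le`
and `userOutageProb_of_ge`.

Limits. Under `x = cos t` Chebyshev quadrature is a midpoint Riemann sum. To let all orders grow
jointly, the approximating functions are shown to converge continuously, hence uniformly on compact
intervals; total quadrature weight at most π then controls the error on bounded intervals. On `(al1,
∞)` a majorant `C * exp (-w)` independent of the orders permits dominated convergence, and the
approximate integrand is a finite combination of exponentials, whose termwise integral is `H2`. -/

noncomputable section

/-! ### Gaussian–Chebyshev quadrature of a fixed function -/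

/-- The Gaussian–Chebyshev quadrature rule of order `n` on `[a, b]`. -/
def chebQuad (n : ℕ) (j : ℝ → ℝ) (a b : ℝ) : ℝ :=
  (b - a) / 2 * ∑ i ∈ Finset.Icc 1 n, Real.pi / n * Real.sqrt (1 - chebNode n i ^ 2) *
    j (((b - a) * chebNode n i + (b + a)) / 2)

/-- The angles whose cosines are the Chebyshev nodes. -/
def chebAngle (n i : ℕ) : ℝ := (2 * (i : ℝ) - 1) * Real.pi / (2 * (n : ℝ))

lemma chebNode_mem (n i : ℕ) : chebNode n i ∈ Set.Icc (-1 : ℝ) 1 :=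
  ⟨Real.neg_one_le_cos _, Real.cos_le_one _⟩

lemma sqrt_one_sub_chebNode_sq {n i : ℕ} (h1 : 1 ≤ i) (hn : i ≤ n) :
    Real.sqrt (1 - chebNode n i ^ 2) = Real.sin (chebAngle n i) := by
  have hn0 : (0 : ℝ) < n := by exact_mod_cast (by omega : 0 < n)
  have hi : (1 : ℝ) ≤ i := by exact_mod_cast h1
  have hin : (i : ℝ) ≤ n := by exact_mod_cast hn
  have h0 : 0 ≤ chebAngle n i := by
    unfold chebAngle
    have : 0 ≤ 2 * (i : ℝ) - 1 := by linarith
    positivity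
  have hpi : chebAngle n i ≤ Real.pi := by
    unfold chebAngle
    rw [div_le_iff₀ (by positivity)]
    nlinarith [Real.pi_pos]
  rw [show chebNode n i = Real.cos (chebAngle n i) from rfl, ← Real.sin_sq,
    Real.sqrt_sq (Real.sin_nonneg_of_nonneg_of_le_pi h0 hpi)]

/-- Midpoint Riemann sums of a continuous function on `[0, π]` converge to its integral. -/
lemma tendsto_midpoint_sum {h : ℝ → ℝ} (hc : Continuous h) :
    Tendsto (fun n : ℕ => ∑ i ∈ Finset.range n, Real.pi / n * h (chebAngle n (i + 1))) atTop
      (𝓝 (∫ t in (0 : ℝ)..Real.pi, h t)) := by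
  have huc := (isCompact_Icc (a := (0 : ℝ)) (b := Real.pi)).uniformContinuousOn_of_continuous
    hc.continuousOn
  rw [Metric.uniformContinuousOn_iff] at huc
  rw [Metric.tendsto_atTop]
  intro ε hε
  -- An error of `ε / (2π)` per unit length costs `ε / 2` over `[0, π]`.
  obtain ⟨δ, hδ, hd⟩ := huc (ε / (2 * Real.pi)) (by positivity)
  obtain ⟨n₀, hn₀⟩ := exists_nat_gt (Real.pi / δ)
  refine ⟨n₀ + 1, fun n hn => ?_⟩
  have hnn : (n₀ : ℝ) + 1 ≤ n := by exact_mod_cast hn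
  have hnpos : (0 : ℝ) < n := by
    have : (0 : ℝ) ≤ n₀ := Nat.cast_nonneg _
    linarith
  have hw : Real.pi / n < δ := by
    rw [div_lt_iff₀ hnpos]
    rw [div_lt_iff₀ hδ] at hn₀
    nlinarith
  have hsplit : ∫ t in (0 : ℝ)..Real.pi, h t =
      ∑ i ∈ Finset.range n, ∫ t in (i * (Real.pi / n))..((i + 1 : ℕ) * (Real.pi / n)), h t := by
    rw [intervalIntegral.sum_integral_adjacent_intervals (a := fun i : ℕ => i * (Real.pi / n))
      (fun k _ => hc.intervalIntegrable _ _)]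
    congr 1
    · simp
    · field_simp
  rw [hsplit, Real.dist_eq, ← Finset.sum_sub_distrib]
  have hterm : ∀ i ∈ Finset.range n, |Real.pi / n * h (chebAngle n (i + 1)) -
      ∫ t in (i * (Real.pi / n))..((i + 1 : ℕ) * (Real.pi / n)), h t| ≤
      ε / (2 * Real.pi) * (Real.pi / n) := by
    intro i hi
    have hin : (i : ℝ) + 1 ≤ n := by exact_mod_cast Finset.mem_range.1 hi
    have hi0 : (0 : ℝ) ≤ i := Nat.cast_nonneg _
    have hconst : Real.pi / n * h (chebAngle n (i + 1)) =
        ∫ t in (i * (Real.pi / n))..((i + 1 : ℕ) * (Real.pi / n)), h (chebAngle n (i + 1)) := by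
      rw [intervalIntegral.integral_const, smul_eq_mul]
      push_cast
      ring
    -- The angle is the midpoint of the `i`-th cell, hence within `π / n < δ` of all its points.
    have hang : chebAngle n (i + 1) = (i + 1 / 2) * (Real.pi / n) := by
      unfold chebAngle
      push_cast
      field_simp
      ring
    have hp : 0 < Real.pi / n := div_pos Real.pi_pos hnpos
    have hn1 : (n : ℝ) * (Real.pi / n) = Real.pi := by field_simp
    rw [hconst, ← intervalIntegral.integral_sub (by simp) (hc.intervalIntegrable _ _)]
    have := intervalIntegral.norm_integral_le_of_norm_le_const
      (a := i * (Real.pi / n)) (b := (i + 1 : ℕ) * (Real.pi / n))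
      (f := fun t => h (chebAngle n (i + 1)) - h t) (C := ε / (2 * Real.pi)) ?_
    · rw [Real.norm_eq_abs] at this
      refine this.trans (le_of_eq ?_)
      congr 1
      push_cast
      rw [show ((i : ℝ) + 1) * (Real.pi / n) - i * (Real.pi / n) = Real.pi / n by ring,
        abs_of_pos hp]
    · intro t ht
      rw [Set.uIoc_of_le (by push_cast; nlinarith)] at ht
      obtain ⟨ht1, ht2⟩ := ht
      push_cast at ht2
      refine (hd _ ?_ _ ?_ ?_).le
      · rw [hang]
        constructor
        · positivity
        · nlinarith
      · constructor
        · exact le_trans (by positivity) ht1.le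
        · nlinarith
      · rw [hang, Real.dist_eq]
        refine lt_of_le_of_lt ?_ hw
        rw [abs_le]
        constructor <;> nlinarith
  calc |∑ i ∈ Finset.range n, _| ≤ ∑ i ∈ Finset.range n, |_| := Finset.abs_sum_le_sum_abs _ _
    _ ≤ ∑ i ∈ Finset.range n, ε / (2 * Real.pi) * (Real.pi / n) := Finset.sum_le_sum hterm
    _ = ε / 2 := by
      rw [Finset.sum_const, Finset.card_range, nsmul_eq_mul]
      have := Real.pi_pos
      field_simp
    _ < ε := by linarith

lemma chebQuad_eq_sum_range (n : ℕ) (j : ℝ → ℝ) (a b : ℝ) :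
    chebQuad n j a b = (b - a) / 2 * ∑ i ∈ Finset.range n, Real.pi / n *
      (Real.sin (chebAngle n (i + 1)) *
        j (((b - a) * Real.cos (chebAngle n (i + 1)) + (b + a)) / 2)) := by
  unfold chebQuad
  congr 1
  rw [Finset.range_eq_Ico, Finset.sum_Ico_add' (fun i => Real.pi / n *
      (Real.sin (chebAngle n i) * j (((b - a) * Real.cos (chebAngle n i) + (b + a)) / 2))) 0 n 1]
  refine Finset.sum_congr rfl fun i hi => ?_
  have hi : 0 + 1 ≤ i ∧ i < n + 1 := Finset.mem_Ico.1 hi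
  rw [sqrt_one_sub_chebNode_sq (by omega) (by omega), mul_assoc]
  rfl

lemma tendsto_chebQuad {j : ℝ → ℝ} (hj : Continuous j) (a b : ℝ) :
    Tendsto (fun n => chebQuad n j a b) atTop (𝓝 (∫ x in a..b, j x)) := by
  have h := (tendsto_midpoint_sum (h := fun t => Real.sin t *
    j (((b - a) * Real.cos t + (b + a)) / 2)) (by fun_prop)).const_mul ((b - a) / 2)
  simp only [chebQuad_eq_sum_range]
  convert h using 2
  -- The quadrature weight is the Jacobian `sin t` of this substitution. It maps `0` to `b` and `π`
  -- to `a`; the reversal cancels the sign of the derivative of cosine.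
  have hs := intervalIntegral.integral_comp_mul_deriv (a := 0) (b := Real.pi)
    (f := fun t => ((b - a) * Real.cos t + (b + a)) / 2)
    (f' := fun t => ((b - a) * (-Real.sin t)) / 2) (g := j)
    (fun t _ => (((Real.hasDerivAt_cos t).const_mul _).add_const _).div_const _)
    (by fun_prop) hj
  simp only [Real.cos_zero, Real.cos_pi, Function.comp] at hs
  rw [show ((b - a) * 1 + (b + a)) / 2 = b by ring,
    show ((b - a) * -1 + (b + a)) / 2 = a by ring] at hs
  rw [intervalIntegral.integral_symm, ← hs, ← intervalIntegral.integral_neg,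
    ← intervalIntegral.integral_const_mul]
  congr 1
  ext t
  ring

lemma chebQuad_point_mem {a b : ℝ} (hab : a ≤ b) (n i : ℕ) :
    ((b - a) * chebNode n i + (b + a)) / 2 ∈ Set.Icc a b := by
  obtain ⟨h1, h2⟩ := chebNode_mem n i
  constructor <;> nlinarith

/-- A bound uniform in the order: a uniform error in the integrand costs at most `π (b - a) / 2`
times that error in the quadrature. -/
lemma sum_chebWeight_le (n : ℕ) :
    ∑ i ∈ Finset.Icc 1 n, Real.pi / n * Real.sqrt (1 - chebNode n i ^ 2) ≤ Real.pi := by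
  calc _ ≤ ∑ i ∈ Finset.Icc 1 n, Real.pi / n * 1 := by
        refine Finset.sum_le_sum fun i _ => mul_le_mul_of_nonneg_left ?_ (by positivity)
        exact Real.sqrt_le_one.2 (by nlinarith [sq_nonneg (chebNode n i)])
    _ ≤ Real.pi := by
      rcases Nat.eq_zero_or_pos n with rfl | hn
      · simpa using Real.pi_pos.le
      · have : (0 : ℝ) < n := by exact_mod_cast hn
        simp only [Finset.sum_const, Nat.card_Icc, nsmul_eq_mul]
        rw [Nat.add_sub_cancel]
        apply le_of_eq
        field_simp

/-! ### Continuous convergence and quadrature of varying integrands -/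

/-- `F p` converges continuously to `f` along `l`: `F p (x p) → f x` whenever `x p → x`. -/
def ContConv {ι : Type*} (l : Filter ι) (F : ι → ℝ → ℝ) (f : ℝ → ℝ) : Prop :=
  ∀ x, Tendsto (fun q : ι × ℝ => F q.1 q.2) (l ×ˢ 𝓝 x) (𝓝 (f x))

namespace ContConv

variable {ι κ : Type*} {l : Filter ι} {m : Filter κ} {F G : ι → ℝ → ℝ} {f g : ℝ → ℝ}

lemma tendsto (h : ContConv l F f) (x : ℝ) : Tendsto (fun p => F p x) l (𝓝 (f x)) :=
  (h x).comp (tendsto_id.prodMk (tendsto_const_nhds (x := x)))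

lemma mul (hF : ContConv l F f) (hG : ContConv l G g) :
    ContConv l (fun p x => F p x * G p x) (fun x => f x * g x) :=
  fun x => (hF x).mul (hG x)

lemma sub (hF : ContConv l F f) (hG : ContConv l G g) :
    ContConv l (fun p x => F p x - G p x) (fun x => f x - g x) :=
  fun x => (hF x).sub (hG x)

lemma pow (hF : ContConv l F f) (k : ℕ) : ContConv l (fun p x => F p x ^ k) (fun x => f x ^ k) :=
  fun x => (hF x).pow k

lemma comp (hF : ContConv l F f) {u : ℝ → ℝ} (hu : Continuous u) :
    ContConv l (fun p x => F p (u x)) (fun x => f (u x)) :=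
  fun x => (hF (u x)).comp (tendsto_fst.prodMk ((hu.tendsto x).comp tendsto_snd))

lemma reindex (hF : ContConv l F f) {r : κ → ι} (hr : Tendsto r m l) :
    ContConv m (fun p => F (r p)) f :=
  fun x => (hF x).comp ((hr.comp tendsto_fst).prodMk tendsto_snd)

/-- Compactness: a neighbourhood filter of the whole interval is a supremum of pointwise ones, even
after a product with `l`, so the local estimates combine into one set of indices. -/
lemma eventually_forall_dist_lt (hF : ContConv l F f) (hf : Continuous f) (a b : ℝ) {ε : ℝ}
    (hε : 0 < ε) : ∀ᶠ p in l, ∀ x ∈ Set.Icc a b, |F p x - f x| < ε := by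
  have hev : ∀ᶠ q in l ×ˢ 𝓝ˢ (Set.Icc a b), |F q.1 q.2 - f q.2| < ε := by
    rw [isCompact_Icc.prod_nhdsSet_eq_biSup]
    simp only [eventually_iSup]
    intro x _
    have h := (hF x).sub ((hf.tendsto x).comp (tendsto_snd (f := l)))
    rw [sub_self] at h
    have := h.eventually (Metric.ball_mem_nhds 0 hε)
    filter_upwards [this] with q hq
    simpa [Real.dist_eq] using hq
  obtain ⟨s, hs, t, ht, hst⟩ := mem_prod_iff.1 hev
  filter_upwards [hs] with p hp x hx
  exact hst (Set.mk_mem_prod hp (subset_of_mem_nhdsSet ht hx))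

/-- Quadrature of continuously convergent integrands. -/
lemma tendsto_chebQuad (hF : ContConv l F f) (hf : Continuous f) {a b : ℝ} (hab : a ≤ b) :
    Tendsto (fun q : ℕ × ι => chebQuad q.1 (F q.2) a b) (atTop ×ˢ l) (𝓝 (∫ x in a..b, f x)) := by
  have h0 := (_root_.tendsto_chebQuad hf a b).comp (tendsto_fst (g := l))
  have hdiff : Tendsto (fun q : ℕ × ι => chebQuad q.1 (F q.2) a b - chebQuad q.1 f a b)
      (atTop ×ˢ l) (𝓝 0) := by
    rw [Metric.tendsto_nhds]
    intro ε hε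
    -- The factor bounds the total weight of the rule; the added one keeps the denominator positive
    -- when `a = b` and makes the final inequality strict.
    set η := ε / ((b - a) / 2 * Real.pi + 1) with hη
    have hba : 0 ≤ (b - a) / 2 := by linarith
    have hη0 : 0 < η := by positivity
    filter_upwards [tendsto_snd.eventually (hF.eventually_forall_dist_lt hf a b hη0)] with q hq
    rw [Real.dist_eq, sub_zero]
    unfold chebQuad
    rw [← mul_sub, ← Finset.sum_sub_distrib, abs_mul, abs_of_nonneg hba]
    calc _ ≤ (b - a) / 2 * ∑ i ∈ Finset.Icc 1 q.1,
          Real.pi / q.1 * Real.sqrt (1 - chebNode q.1 i ^ 2) * η := by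
          refine mul_le_mul_of_nonneg_left ?_ hba
          refine (Finset.abs_sum_le_sum_abs _ _).trans (Finset.sum_le_sum fun i _ => ?_)
          have hw : 0 ≤ Real.pi / q.1 * Real.sqrt (1 - chebNode q.1 i ^ 2) := by positivity
          rw [← mul_sub, abs_mul, abs_of_nonneg hw]
          exact mul_le_mul_of_nonneg_left (hq _ (chebQuad_point_mem hab _ _)).le hw
      _ ≤ (b - a) / 2 * (Real.pi * η) := by
          rw [← Finset.sum_mul]
          gcongr
          exact sum_chebWeight_le _
      _ < ε := by
          have : ε = η * ((b - a) / 2 * Real.pi + 1) := by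
            rw [hη, div_mul_cancel₀ _ (by positivity)]
          nlinarith
  have := hdiff.add h0
  simpa using this

end ContConv

lemma contConv_nhds {h : ℝ → ℝ → ℝ} (hh : Continuous (Function.uncurry h)) (y : ℝ) :
    ContConv (𝓝 y) h (h y) := by
  intro x
  rw [← nhds_prod_eq]
  exact hh.tendsto (y, x)

/-- The parameter itself serves as index: as `y' → y`, the integrands `h y'` converge continuously
to `h y`, so order and parameter may move together. -/
lemma contConv_chebQuad {h : ℝ → ℝ → ℝ} (hh : Continuous (Function.uncurry h)) {a b : ℝ}
    (hab : a ≤ b) :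
    ContConv atTop (fun n y => chebQuad n (h y) a b) (fun y => ∫ x in a..b, h y x) := fun y =>
  (contConv_nhds hh y).tendsto_chebQuad
    (hh.comp (f := fun r : ℝ => (y, r)) (Continuous.prodMk_right y)) hab

lemma ContConv.const_mul {ι : Type*} {l : Filter ι} {F : ι → ℝ → ℝ} {f : ℝ → ℝ}
    (h : ContConv l F f) (c : ℝ) : ContConv l (fun p x => c * F p x) (fun x => c * f x) :=
  fun x => (h x).const_mul c

/-! ### The distribution functions and their approximations: convergence and bounds -/

namespace SGFParams

lemma FB_zero (P : SGFParams) : P.FB 0 = 0 := by simp [FB]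

/-- The standing assumptions on the numerical data. -/
structure Admissible (P : SGFParams) : Prop where
  DF_pos : 0 < P.DF
  D0_pos : 0 < P.D0
  D0_lt_D1 : P.D0 < P.D1
  a_pos : 0 < P.a
  PF_pos : 0 < P.PF
  PB_pos : 0 < P.PB
  RF_pos : 0 < P.RF
  RB_pos : 0 < P.RB

namespace Admissible

variable {P : SGFParams} (h : P.Admissible)
include h

lemma gamF_pos : 0 < P.gamF := sub_pos.2 (Real.one_lt_rpow one_lt_two h.RF_pos)

lemma gamB_pos : 0 < P.gamB := sub_pos.2 (Real.one_lt_rpow one_lt_two h.RB_pos)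

lemma alF_pos : 0 < P.alF := div_pos h.gamF_pos h.PF_pos

lemma alB_pos : 0 < P.alB := div_pos h.gamB_pos h.PB_pos

lemma alB_lt_al1 : P.alB < P.al1 := by
  have := h.gamF_pos
  have := h.alB_pos
  unfold al1
  nlinarith

lemma al1_pos : 0 < P.al1 := h.alB_pos.trans h.alB_lt_al1

lemma al1_lt_al2 (hlt : P.gamB * P.gamF < 1) : P.al1 < P.al2 := by
  have h1 := mul_pos h.gamB_pos h.gamF_pos
  unfold al2
  rw [lt_div_iff₀ (by linarith)]
  have := h.al1_pos
  unfold al1 at this ⊢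
  nlinarith

lemma continuous_rpow : Continuous fun r : ℝ => r ^ P.a :=
  Real.continuous_rpow_const h.a_pos.le

lemma continuous_integrand_cdf :
    Continuous (Function.uncurry fun y r : ℝ => (1 - Real.exp (-(1 + r ^ P.a) * y)) * r) := by
  have := h.continuous_rpow
  simp only [Function.uncurry_def]
  have h2 : Continuous fun p : ℝ × ℝ => p.2 ^ P.a := this.comp continuous_snd
  fun_prop

lemma continuous_integrand_density : Continuous (Function.uncurry fun y r : ℝ =>
    (1 + r ^ P.a) * Real.exp (-(1 + r ^ P.a) * y) * r) := by
  have := h.continuous_rpow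
  simp only [Function.uncurry_def]
  have h2 : Continuous fun p : ℝ × ℝ => p.2 ^ P.a := this.comp continuous_snd
  fun_prop

/-- The factor `1 + t` in `Psi` is the polar factor `r = (DF / 2) (1 + t)` at the node. -/
lemma FFapprox_eq (L : ℕ) (y : ℝ) : P.FFapprox L y =
    2 / P.DF ^ 2 * chebQuad L (fun r => (1 - Real.exp (-(1 + r ^ P.a) * y)) * r) 0 P.DF := by
  have hD := h.DF_pos
  unfold FFapprox chebQuad
  simp only [Finset.mul_sum]
  refine Finset.sum_congr rfl fun l hl => ?_
  have hl0 : l ≠ 0 := by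
    have := (Finset.mem_Icc.1 hl).1
    omega
  simp only [Psi, mu, if_neg hl0]
  rw [show ((P.DF - 0) * chebNode L l + (P.DF + 0)) / 2 = P.DF / 2 + P.DF / 2 * chebNode L l by
    ring]
  field_simp
  ring

lemma FBapprox_eq (N : ℕ) (y : ℝ) : P.FBapprox N y = 2 / (P.D1 ^ 2 - P.D0 ^ 2) *
    chebQuad N (fun r => (1 - Real.exp (-(1 + r ^ P.a) * y)) * r) P.D0 P.D1 := by
  have h0 := h.D0_pos
  have h1 : 0 < P.D1 - P.D0 := sub_pos.2 h.D0_lt_D1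
  have h2 : 0 < P.D1 + P.D0 := by linarith
  unfold FBapprox chebQuad
  rw [← mul_assoc, show 2 / (P.D1 ^ 2 - P.D0 ^ 2) * ((P.D1 - P.D0) / 2) = 1 / (P.D1 + P.D0) by
    rw [show P.D1 ^ 2 - P.D0 ^ 2 = (P.D1 - P.D0) * (P.D1 + P.D0) by ring]; field_simp]
  congr 1
  refine Finset.sum_congr rfl fun n _ => ?_
  rw [show ((P.D1 - P.D0) * chebNode N n + (P.D1 + P.D0)) / 2 = P.phi N n by unfold phi; ring]
  simp only [Phi, c]
  ring

lemma fBapprox_eq (N : ℕ) (y : ℝ) : P.fBapprox N y = 2 / (P.D1 ^ 2 - P.D0 ^ 2) *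
    chebQuad N (fun r => (1 + r ^ P.a) * Real.exp (-(1 + r ^ P.a) * y) * r) P.D0 P.D1 := by
  have h0 := h.D0_pos
  have h1 : 0 < P.D1 - P.D0 := sub_pos.2 h.D0_lt_D1
  have h2 : 0 < P.D1 + P.D0 := by linarith
  unfold fBapprox chebQuad
  rw [← mul_assoc, show 2 / (P.D1 ^ 2 - P.D0 ^ 2) * ((P.D1 - P.D0) / 2) = 1 / (P.D1 + P.D0) by
    rw [show P.D1 ^ 2 - P.D0 ^ 2 = (P.D1 - P.D0) * (P.D1 + P.D0) by ring]; field_simp]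
  congr 1
  refine Finset.sum_congr rfl fun n _ => ?_
  rw [show ((P.D1 - P.D0) * chebNode N n + (P.D1 + P.D0)) / 2 = P.phi N n by unfold phi; ring]
  simp only [Phi, c]
  ring

lemma contConv_FFapprox : ContConv atTop P.FFapprox P.FF := by
  have := (contConv_chebQuad h.continuous_integrand_cdf h.DF_pos.le).const_mul (2 / P.DF ^ 2)
  simp only [← h.FFapprox_eq] at this
  exact this

lemma contConv_FBapprox : ContConv atTop P.FBapprox P.FB := by
  have := (contConv_chebQuad h.continuous_integrand_cdf h.D0_lt_D1.le).const_mul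
    (2 / (P.D1 ^ 2 - P.D0 ^ 2))
  simp only [← h.FBapprox_eq] at this
  exact this

lemma contConv_fBapprox : ContConv atTop P.fBapprox P.fB := by
  have := (contConv_chebQuad h.continuous_integrand_density h.D0_lt_D1.le).const_mul
    (2 / (P.D1 ^ 2 - P.D0 ^ 2))
  simp only [← h.fBapprox_eq] at this
  exact this

lemma continuous_FF : Continuous P.FF :=
  (intervalIntegral.continuous_parametric_intervalIntegral_of_continuous
    h.continuous_integrand_cdf continuous_const).const_mul _

lemma continuous_fB : Continuous P.fB :=
  (intervalIntegral.continuous_parametric_intervalIntegral_of_continuous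
    (a₀ := P.D0) (s := fun _ => P.D1) h.continuous_integrand_density continuous_const).const_mul _

lemma hasDerivAt_FB (y : ℝ) : HasDerivAt P.FB (P.fB y) y := by
  refine HasDerivAt.const_mul _ ?_
  have hc := h.continuous_integrand_cdf
  have hd := h.continuous_integrand_density
  -- Differentiation under the integral: on this compact box the continuous `y`-derivative of the
  -- integrand is bounded by a constant.
  have hK : IsCompact (Set.Icc (y - 1) (y + 1) ×ˢ Set.Icc P.D0 P.D1) :=
    isCompact_Icc.prod isCompact_Icc
  obtain ⟨C, hC⟩ := hK.exists_bound_of_continuousOn hd.continuousOn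
  have hs : ∀ z : ℝ, Continuous fun r : ℝ => (1 - Real.exp (-(1 + r ^ P.a) * z)) * r := fun z =>
    hc.comp (f := fun r : ℝ => (z, r)) (by fun_prop)
  have hs' : ∀ z : ℝ, Continuous fun r : ℝ => (1 + r ^ P.a) * Real.exp (-(1 + r ^ P.a) * z) * r :=
    fun z => hd.comp (f := fun r : ℝ => (z, r)) (by fun_prop)
  refine (intervalIntegral.hasDerivAt_integral_of_dominated_loc_of_deriv_le
    (F := fun z r => (1 - Real.exp (-(1 + r ^ P.a) * z)) * r)
    (F' := fun z r => (1 + r ^ P.a) * Real.exp (-(1 + r ^ P.a) * z) * r)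
    (bound := fun _ => C) (s := Set.Icc (y - 1) (y + 1))
    (Icc_mem_nhds (by linarith) (by linarith)) ?_ ((hs y).intervalIntegrable _ _)
    (hs' y).aestronglyMeasurable ?_ (by simp) ?_).2
  · exact Eventually.of_forall fun z => (hs z).aestronglyMeasurable
  · refine ae_of_all _ fun r hr z hz => hC (z, r) ⟨hz, ?_⟩
    rw [Set.uIoc_of_le h.D0_lt_D1.le] at hr
    exact ⟨hr.1.le, hr.2⟩
  · refine ae_of_all _ fun r _ z _ => ?_
    have h1 : HasDerivAt (fun z : ℝ => -(1 + r ^ P.a) * z) (-(1 + r ^ P.a)) z := by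
      simpa using (hasDerivAt_id z).const_mul (-(1 + r ^ P.a))
    have := (h1.exp.const_sub 1).mul_const r
    refine this.congr_deriv ?_
    ring

lemma fB_nonneg (y : ℝ) : 0 ≤ P.fB y := by
  have h0 := h.D0_pos
  have h1 := h.D0_lt_D1
  refine mul_nonneg (div_nonneg zero_le_two (by nlinarith)) ?_
  refine intervalIntegral.integral_nonneg h1.le fun r hr => ?_
  have : 0 < r := h0.trans_le hr.1
  positivity

lemma phi_mem (N n : ℕ) : P.phi N n ∈ Set.Icc P.D0 P.D1 := by
  have := chebQuad_point_mem h.D0_lt_D1.le N n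
  rwa [show ((P.D1 - P.D0) * chebNode N n + (P.D1 + P.D0)) / 2 = P.phi N n by unfold phi; ring]
    at this

lemma one_le_c (N n : ℕ) : 1 ≤ P.c N n := by
  have : 0 ≤ P.phi N n := h.D0_pos.le.trans (h.phi_mem N n).1
  unfold c
  linarith [Real.rpow_nonneg this P.a]

lemma mu_nonneg (L l : ℕ) : 0 ≤ P.mu L l := by
  unfold mu
  split_ifs
  · exact le_rfl
  · have := (chebNode_mem L l).1
    have hD := h.DF_pos
    have : 0 ≤ P.DF / 2 + P.DF / 2 * chebNode L l := by nlinarith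
    positivity

/-- In `Psi` the factor `1 + t` is at most `2`, which the prefactor `1 / 2` cancels; the remaining
weights sum to at most π. Uniformity in `L` is what matters, not the constant. -/
lemma abs_FFapprox_le (L : ℕ) {y : ℝ} (hy : 0 ≤ y) : |P.FFapprox L y| ≤ Real.pi := by
  unfold FFapprox
  rw [abs_mul, abs_of_pos (by norm_num : (0 : ℝ) < 1 / 2)]
  have hle : |∑ l ∈ Finset.Icc 1 L, Psi L l * (1 - Real.exp (-P.mu L l * y))| ≤
      2 * ∑ l ∈ Finset.Icc 1 L, Real.pi / L * Real.sqrt (1 - chebNode L l ^ 2) := by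
    rw [Finset.mul_sum]
    refine (Finset.abs_sum_le_sum_abs _ _).trans (Finset.sum_le_sum fun l hl => ?_)
    have hl0 : l ≠ 0 := by
      have := (Finset.mem_Icc.1 hl).1
      omega
    obtain ⟨h1, h2⟩ := chebNode_mem L l
    have hw : 0 ≤ Real.pi / L * Real.sqrt (1 - chebNode L l ^ 2) := by positivity
    have he : Real.exp (-P.mu L l * y) ≤ 1 := by
      rw [Real.exp_le_one_iff]
      have := h.mu_nonneg L l
      nlinarith
    have he0 := Real.exp_pos (-P.mu L l * y)
    rw [Psi, if_neg hl0, abs_mul, abs_mul, abs_of_nonneg hw,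
      abs_of_nonneg (by linarith : 0 ≤ 1 + chebNode L l),
      abs_of_nonneg (by linarith : 0 ≤ 1 - Real.exp (-P.mu L l * y)), mul_assoc, mul_comm 2]
    refine mul_le_mul_of_nonneg_left ?_ hw
    nlinarith
  linarith [sum_chebWeight_le L]

/-- Since `c ≥ 1`, each exponential decays at least like `exp (-y)`; the nodes lie in `[D0, D1]`,
which bounds the coefficients uniformly in `N`. -/
lemma abs_fBapprox_le (N : ℕ) {y : ℝ} (hy : 0 ≤ y) : |P.fBapprox N y| ≤
    1 / (P.D1 + P.D0) * (P.D1 * (1 + P.D1 ^ P.a) * Real.pi) * Real.exp (-y) := by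
  have h0 := h.D0_pos
  have h1 := h.D0_lt_D1
  have h2 : 0 < P.D1 + P.D0 := by linarith
  have hD1 : 0 < P.D1 := by linarith
  unfold fBapprox
  rw [abs_mul, abs_of_pos (by positivity), mul_assoc]
  refine mul_le_mul_of_nonneg_left ?_ (by positivity)
  calc _ ≤ ∑ n ∈ Finset.Icc 1 N, Real.pi / N * Real.sqrt (1 - chebNode N n ^ 2) *
        (P.D1 * (1 + P.D1 ^ P.a) * Real.exp (-y)) := by
        refine (Finset.abs_sum_le_sum_abs _ _).trans (Finset.sum_le_sum fun n _ => ?_)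
        obtain ⟨hp0, hp1⟩ := h.phi_mem N n
        have hp : 0 ≤ P.phi N n := h0.le.trans hp0
        have hc := h.one_le_c N n
        have hc2 : P.c N n ≤ 1 + P.D1 ^ P.a := by
          unfold c
          gcongr
          exact h.a_pos.le
        have hw : 0 ≤ Real.pi / N * Real.sqrt (1 - chebNode N n ^ 2) := by positivity
        rw [abs_of_nonneg (by unfold Phi; positivity), Phi, mul_assoc, mul_assoc]
        refine mul_le_mul_of_nonneg_left ?_ hw
        rw [← mul_assoc]
        gcongr
        nlinarith
    _ = (∑ n ∈ Finset.Icc 1 N, Real.pi / N * Real.sqrt (1 - chebNode N n ^ 2)) *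
        (P.D1 * (1 + P.D1 ^ P.a) * Real.exp (-y)) := by rw [Finset.sum_mul]
    _ ≤ Real.pi * (P.D1 * (1 + P.D1 ^ P.a) * Real.exp (-y)) := by
        gcongr
        exact sum_chebWeight_le N
    _ = _ := by ring

lemma abs_FF_le {y : ℝ} (hy : 0 ≤ y) : |P.FF y| ≤ Real.pi :=
  le_of_tendsto (h.contConv_FFapprox.tendsto y).abs
    (Eventually.of_forall fun L => h.abs_FFapprox_le L hy)

lemma abs_fB_le {y : ℝ} (hy : 0 ≤ y) : |P.fB y| ≤
    1 / (P.D1 + P.D0) * (P.D1 * (1 + P.D1 ^ P.a) * Real.pi) * Real.exp (-y) :=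
  le_of_tendsto (h.contConv_fBapprox.tendsto y).abs
    (Eventually.of_forall fun L => h.abs_fBapprox_le L hy)

lemma integrableOn_fB : IntegrableOn P.fB (Set.Ioi 0) := by
  refine Integrable.mono' (g := fun y =>
    1 / (P.D1 + P.D0) * (P.D1 * (1 + P.D1 ^ P.a) * Real.pi) * Real.exp (-y))
    ((integrableOn_exp_neg_Ioi 0).const_mul _) h.continuous_fB.aestronglyMeasurable ?_
  filter_upwards [ae_restrict_mem measurableSet_Ioi] with y hy
  exact h.abs_fB_le (le_of_lt hy)

end Admissible

/-! ### Convergence of the quadrature terms on bounded intervals -/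

section Integrands

variable (P : SGFParams) {ι κ : Type*} {l : Filter ι} {F : ι → ℝ → ℝ} {g : ι → ℝ → ℝ}
  {F₀ g₀ : ℝ → ℝ}

lemma contConv_integrand1 (hF : ContConv l F F₀) (hg : ContConv l g g₀) (k : ℕ) :
    ContConv l (fun i => P.integrand1 (F i) (g i) k) (P.integrand1 F₀ g₀ k) := by
  have hv := hF.comp (u := fun w => (P.alB⁻¹ * w - 1) / P.PF) (by fun_prop)
  have hu := hF.comp (u := fun w => P.alF * P.PB * w + P.alF) (by fun_prop)
  exact (hg.mul (hv.pow k)).mul ((hu.sub hv).pow (P.K - k))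

lemma contConv_integrand2 (hF : ContConv l F F₀) (hg : ContConv l g g₀) (k : ℕ) :
    ContConv l (fun i => P.integrand2 (F i) (g i) k) (P.integrand2 F₀ g₀ k) := by
  have hv := hF.comp (u := fun w => (P.alB⁻¹ * w - 1) / P.PF) (by fun_prop)
  have hu := hF.comp (u := fun w => P.alF * P.PB * w + P.alF) (by fun_prop)
  have hc := hF.comp (u := fun _ => P.alF) (by fun_prop)
  exact (hg.mul (hc.pow k)).mul ((hu.sub hv).pow (P.K - k))

lemma contConv_integrand3 (hF : ContConv l F F₀) (hg : ContConv l g g₀) :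
    ContConv l (fun i => P.integrand3 (F i) (g i)) (P.integrand3 F₀ g₀) :=
  hg.mul ((hF.comp (u := fun w => P.alF * P.PB * w + P.alF) (by fun_prop)).pow P.K)

lemma continuous_integrand1 (hF : Continuous F₀) (hg : Continuous g₀) (k : ℕ) :
    Continuous (P.integrand1 F₀ g₀ k) := by
  unfold integrand1
  fun_prop

lemma continuous_integrand2 (hF : Continuous F₀) (hg : Continuous g₀) (k : ℕ) :
    Continuous (P.integrand2 F₀ g₀ k) := by
  unfold integrand2
  fun_prop

lemma continuous_integrand3 (hF : Continuous F₀) (hg : Continuous g₀) :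
    Continuous (P.integrand3 F₀ g₀) := by
  unfold integrand3
  fun_prop

lemma continuous_FFapprox (L : ℕ) : Continuous (P.FFapprox L) := by
  unfold FFapprox
  fun_prop

lemma continuous_fBapprox (N : ℕ) : Continuous (P.fBapprox N) := by
  unfold fBapprox
  fun_prop

end Integrands

namespace Admissible

variable {P : SGFParams} (h : P.Admissible)
include h

lemma tendsto_G1 (k : ℕ) : Tendsto
    (fun n : ℕ × ℕ × ℕ => P.G1 (P.FFapprox n.2.1) (P.fBapprox n.2.2) n.1 k)
    atTop (𝓝 (P.I1 P.FF P.fB k)) := by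
  have := (P.contConv_integrand1 (h.contConv_FFapprox.reindex (tendsto_fst (g := atTop)))
    (h.contConv_fBapprox.reindex (tendsto_snd (f := atTop))) k).tendsto_chebQuad
    (P.continuous_integrand1 h.continuous_FF h.continuous_fB k) h.alB_lt_al1.le
  rwa [prod_atTop_atTop_eq, prod_atTop_atTop_eq] at this

lemma tendsto_G2 (hlt : P.gamB * P.gamF < 1) (k : ℕ) : Tendsto
    (fun n : ℕ × ℕ × ℕ => P.G2 (P.FFapprox n.2.1) (P.fBapprox n.2.2) n.1 k)
    atTop (𝓝 (P.I2 P.FF P.fB k)) := by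
  have := (P.contConv_integrand2 (h.contConv_FFapprox.reindex (tendsto_fst (g := atTop)))
    (h.contConv_fBapprox.reindex (tendsto_snd (f := atTop))) k).tendsto_chebQuad
    (P.continuous_integrand2 h.continuous_FF h.continuous_fB k) (h.al1_lt_al2 hlt).le
  rwa [prod_atTop_atTop_eq, prod_atTop_atTop_eq] at this

lemma tendsto_G3 : Tendsto
    (fun n : ℕ × ℕ × ℕ => P.G3 (P.FFapprox n.2.1) (P.fBapprox n.2.2) n.1)
    atTop (𝓝 (P.I3 P.FF P.fB)) := by
  have := (P.contConv_integrand3 (h.contConv_FFapprox.reindex (tendsto_fst (g := atTop)))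
    (h.contConv_fBapprox.reindex (tendsto_snd (f := atTop)))).tendsto_chebQuad
    (P.continuous_integrand3 h.continuous_FF h.continuous_fB) h.alB_pos.le
  rw [prod_atTop_atTop_eq, prod_atTop_atTop_eq] at this
  refine this.congr fun n => ?_
  unfold G3 chebQuad
  rw [sub_zero]
  congr 1
  refine Finset.sum_congr rfl fun i _ => ?_
  rw [show (P.alB * chebNode n.1 i + (P.alB + 0)) / 2 = (chebNode n.1 i + 1) * P.alB / 2 by ring]

lemma tendsto_I4 : Tendsto (fun n : ℕ × ℕ => P.I4 (P.FFapprox n.1) (P.FBapprox n.2))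
    atTop (𝓝 (P.I4 P.FF P.FB)) := by
  rw [← prod_atTop_atTop_eq]
  exact (tendsto_const_nhds.sub ((h.contConv_FBapprox.tendsto P.al2).comp tendsto_snd)).mul
    (((h.contConv_FFapprox.tendsto P.alF).comp tendsto_fst).pow P.K)

end Admissible

end SGFParams

/-! ### The closed form on the half-line and its limit -/

/-- `f` is integrable on `(a, ∞)` with integral `v`. -/
def HasIntegralIoi (a : ℝ) (f : ℝ → ℝ) (v : ℝ) : Prop :=
  IntegrableOn f (Set.Ioi a) ∧ ∫ w in Set.Ioi a, f w = v

namespace HasIntegralIoi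

variable {a : ℝ}

lemma sum {ι : Type*} (s : Finset ι) {f : ι → ℝ → ℝ} {v : ι → ℝ}
    (hf : ∀ i ∈ s, HasIntegralIoi a (f i) (v i)) :
    HasIntegralIoi a (fun w => ∑ i ∈ s, f i w) (∑ i ∈ s, v i) :=
  ⟨integrable_finsetSum s fun i hi => (hf i hi).1, by
    rw [integral_finsetSum s fun i hi => (hf i hi).1]
    exact Finset.sum_congr rfl fun i hi => (hf i hi).2⟩

lemma const_mul {f : ℝ → ℝ} {v : ℝ} (hf : HasIntegralIoi a f v) (c : ℝ) :
    HasIntegralIoi a (fun w => c * f w) (c * v) :=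
  ⟨hf.1.const_mul c, by rw [integral_const_mul, hf.2]⟩

lemma exp_neg_mul {S : ℝ} (hS : 0 < S) :
    HasIntegralIoi a (fun w => Real.exp (-S * w)) (Real.exp (-S * a) / S) :=
  ⟨integrableOn_exp_mul_Ioi (by linarith) a, by
    rw [integral_exp_mul_Ioi (by linarith), neg_div_neg_eq]⟩

end HasIntegralIoi

namespace SGFParams

/-- Constants cancel in the difference, leaving pure exponentials. As `mu` vanishes at `0`, the
extra index contributes the same constant to both sums and cancels too. -/
lemma FFapprox_sub (P : SGFParams) (L : ℕ) (y z : ℝ) :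
    P.FFapprox L y - P.FFapprox L z = (-1 / 2) *
      (∑ l ∈ Finset.range (L + 1), Psi L l * Real.exp (-P.mu L l * y) -
        ∑ l ∈ Finset.range (L + 1), Psi L l * Real.exp (-P.mu L l * z)) := by
  have hs : ∀ f : ℕ → ℝ, ∑ l ∈ Finset.range (L + 1), f l = f 0 + ∑ l ∈ Finset.Icc 1 L, f l := by
    intro f
    rw [Finset.range_eq_Ico, Finset.sum_eq_sum_Ico_succ_bot (Nat.succ_pos L)]
    rfl
  rw [hs, hs]
  unfold FFapprox
  rw [← mul_sub, ← Finset.sum_sub_distrib, add_sub_add_comm, ← Finset.sum_sub_distrib]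
  have h0 : P.mu L 0 = 0 := if_pos rfl
  rw [h0]
  simp only [neg_zero, zero_mul, sub_self, zero_add, Finset.mul_sum]
  refine Finset.sum_congr rfl fun l _ => ?_
  ring

lemma sub_pow_eq_sum_multinomial (A B : ℕ → ℝ) (L d : ℕ) :
    (∑ l ∈ Finset.range (L + 1), A l - ∑ l ∈ Finset.range (L + 1), B l) ^ d =
      ∑ m ∈ Finset.range (d + 1), (d.choose m : ℝ) * (-1) ^ m *
        ∑ p ∈ (Finset.range (L + 1)).piAntidiag (d - m),
          (Nat.multinomial (Finset.range (L + 1)) p : ℝ) *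
        ∑ q ∈ (Finset.range (L + 1)).piAntidiag m,
          (Nat.multinomial (Finset.range (L + 1)) q : ℝ) *
          ∏ l ∈ Finset.range (L + 1), A l ^ p l * B l ^ q l := by
  -- This order puts the exponent `m` on the subtracted sum, as in `H2`.
  rw [show ∀ x y : ℝ, x - y = -y + x from fun x y => by ring, add_pow]
  refine Finset.sum_congr rfl fun m _ => ?_
  rw [neg_pow, Finset.sum_pow_eq_sum_piAntidiag, Finset.sum_pow_eq_sum_piAntidiag]
  simp only [Finset.prod_mul_distrib]
  have : ∀ (X : Finset (ℕ → ℕ)) (Y : Finset (ℕ → ℕ)) (u v s t : (ℕ → ℕ) → ℝ),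
      ∑ p ∈ X, u p * ∑ q ∈ Y, v q * (s p * t q) =
        (∑ q ∈ Y, v q * t q) * (∑ p ∈ X, u p * s p) := by
    intro X Y u v s t
    rw [Finset.mul_sum]
    refine Finset.sum_congr rfl fun p _ => ?_
    rw [Finset.sum_mul, Finset.mul_sum]
    refine Finset.sum_congr rfl fun q _ => ?_
    ring
  rw [this]
  ring

/-- The exponent `S` in the closed form `H2`. -/
def expRate (P : SGFParams) (L N n : ℕ) (p q : ℕ → ℕ) : ℝ :=
  (∑ l ∈ Finset.range (L + 1), ((p l : ℝ) * P.mu L l * P.alF * P.PB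
        + (q l : ℝ) * P.mu L l * P.PF⁻¹ * P.alB⁻¹)) + P.c N n

/-- The exponents are affine in `w`: their constant parts give the second factor, their slopes
together with `c` give `expRate`. -/
lemma prod_exp_eq (P : SGFParams) (L N n : ℕ) (p q : ℕ → ℕ) (w : ℝ) :
    (∏ l ∈ Finset.range (L + 1),
      (Psi L l * Real.exp (-P.mu L l * (P.alF * P.PB * w + P.alF))) ^ p l *
      (Psi L l * Real.exp (-P.mu L l * ((P.alB⁻¹ * w - 1) / P.PF))) ^ q l) *
      Real.exp (-P.c N n * w) =
    (∏ l ∈ Finset.range (L + 1), Psi L l ^ (p l + q l)) *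
    Real.exp (∑ l ∈ Finset.range (L + 1),
      ((q l : ℝ) * P.mu L l * P.PF⁻¹ - (p l : ℝ) * P.mu L l * P.alF)) *
    Real.exp (-P.expRate L N n p q * w) := by
  unfold expRate
  rw [neg_add, add_mul, Real.exp_add, ← mul_assoc, mul_assoc (∏ l ∈ _, _) (Real.exp _),
    ← Real.exp_add]
  congr 1
  rw [neg_mul, Finset.sum_mul, ← Finset.sum_neg_distrib, ← Finset.sum_add_distrib, Real.exp_sum,
    ← Finset.prod_mul_distrib]
  refine Finset.prod_congr rfl fun l _ => ?_
  rw [mul_pow, mul_pow, pow_add, ← Real.exp_nat_mul, ← Real.exp_nat_mul,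
    mul_mul_mul_comm, ← Real.exp_add]
  congr 2
  ring

lemma integrand2_approx_eq (P : SGFParams) (L N k : ℕ) (w : ℝ) :
    P.integrand2 (P.FFapprox L) (P.fBapprox N) k w =
  (-1 / 2) ^ (P.K - k) * (P.FFapprox L P.alF ^ k / (P.D0 + P.D1)) *
  ∑ n ∈ Finset.Icc 1 N, P.Phi N n * P.c N n *
  ∑ m ∈ Finset.range (P.K - k + 1), ((P.K - k).choose m : ℝ) * (-1) ^ m *
  ∑ p ∈ (Finset.range (L + 1)).piAntidiag (P.K - k - m),
    (Nat.multinomial (Finset.range (L + 1)) p : ℝ) *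
  ∑ q ∈ (Finset.range (L + 1)).piAntidiag m,
    (Nat.multinomial (Finset.range (L + 1)) q : ℝ) *
    (∏ l ∈ Finset.range (L + 1), Psi L l ^ (p l + q l)) *
    Real.exp (∑ l ∈ Finset.range (L + 1),
      ((q l : ℝ) * P.mu L l * P.PF⁻¹ - (p l : ℝ) * P.mu L l * P.alF)) *
    Real.exp (-P.expRate L N n p q * w) := by
  unfold integrand2
  rw [FFapprox_sub, mul_pow, sub_pow_eq_sum_multinomial, fBapprox]
  rw [show ∀ s x y z t : ℝ, 1 / (P.D1 + P.D0) * s * x * (y * z) =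
    y * (x / (P.D0 + P.D1)) * (s * z) from fun s x y z t => by rw [add_comm P.D0]; ring]
  · congr 1
    rw [Finset.sum_mul]
    refine Finset.sum_congr rfl fun n _ => ?_
    rw [mul_assoc (P.Phi N n * P.c N n)]
    congr 1
    rw [Finset.mul_sum]
    refine Finset.sum_congr rfl fun m _ => ?_
    rw [mul_left_comm]
    congr 1
    rw [Finset.mul_sum]
    refine Finset.sum_congr rfl fun p _ => ?_
    rw [mul_left_comm]
    congr 1
    rw [Finset.mul_sum]
    refine Finset.sum_congr rfl fun q _ => ?_
    rw [mul_left_comm, mul_comm (Real.exp _), prod_exp_eq]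
    ring
  -- The quantified identity does not contain its variable `t`, so rewriting leaves its value open;
  -- any real number does.
  · exact 0

namespace Admissible

variable {P : SGFParams} (h : P.Admissible)
include h

lemma expRate_pos (L N n : ℕ) (p q : ℕ → ℕ) : 0 < P.expRate L N n p q := by
  have h1 := h.alF_pos
  have h2 := h.alB_pos
  have h3 := h.PF_pos
  have h4 := h.PB_pos
  have hc := h.one_le_c N n
  have : 0 ≤ ∑ l ∈ Finset.range (L + 1), ((p l : ℝ) * P.mu L l * P.alF * P.PB
        + (q l : ℝ) * P.mu L l * P.PF⁻¹ * P.alB⁻¹) := by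
    refine Finset.sum_nonneg fun l _ => ?_
    have := h.mu_nonneg L l
    positivity
  unfold expRate
  linarith

lemma hasIntegralIoi_integrand2 (L N k : ℕ) :
    HasIntegralIoi P.al1 (P.integrand2 (P.FFapprox L) (P.fBapprox N) k) (P.H2 L N k) := by
  rw [funext (P.integrand2_approx_eq L N k)]
  refine (HasIntegralIoi.sum _ fun n _ => (HasIntegralIoi.sum _ fun m _ =>
    (HasIntegralIoi.sum _ fun p _ => (HasIntegralIoi.sum _ fun q _ =>
      ?_).const_mul _).const_mul _).const_mul _).const_mul _
  exact (HasIntegralIoi.exp_neg_mul (h.expRate_pos L N n p q)).const_mul _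

/-- An integrable majorant of `integrand2`. -/
lemma norm_integrand2_le {F f : ℝ → ℝ} {C : ℝ} (hF : ∀ y, 0 ≤ y → |F y| ≤ Real.pi)
    (hf : ∀ y, 0 ≤ y → |f y| ≤ C * Real.exp (-y)) (k : ℕ) {w : ℝ} (hw : w ∈ Set.Ioi P.al1) :
    ‖P.integrand2 F f k w‖ ≤
      C * Real.pi ^ k * (Real.pi + Real.pi) ^ (P.K - k) * Real.exp (-w) := by
  have hw1 : P.al1 < w := hw
  have h1 := h.alB_lt_al1
  have hB := h.alB_pos
  have hw0 : 0 ≤ w := by linarith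
  have hFF := h.alF_pos
  have hPF := h.PF_pos
  have hPB := h.PB_pos
  -- The bounds on `F` hold only at nonnegative arguments; this one is nonnegative because `w > al1
  -- > alB`.
  have hv : 0 ≤ (P.alB⁻¹ * w - 1) / P.PF := by
    refine div_nonneg ?_ hPF.le
    rw [sub_nonneg, inv_mul_eq_div, one_le_div hB]
    linarith
  have hu : 0 ≤ P.alF * P.PB * w + P.alF := by positivity
  unfold integrand2
  rw [Real.norm_eq_abs, abs_mul, abs_mul, abs_pow, abs_pow]
  have hsub := (abs_sub (F (P.alF * P.PB * w + P.alF)) (F ((P.alB⁻¹ * w - 1) / P.PF))).trans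
    (add_le_add (hF _ hu) (hF _ hv))
  calc _ ≤ C * Real.exp (-w) * Real.pi ^ k * (Real.pi + Real.pi) ^ (P.K - k) := by
        have hfw := hf w hw0
        have := (abs_nonneg _).trans hfw
        gcongr
        exact hF _ hFF.le
    _ = _ := by ring

lemma integrableOn_integrand2 (k : ℕ) :
    IntegrableOn (P.integrand2 P.FF P.fB k) (Set.Ioi P.al1) := by
  have hle := fun w hw => h.norm_integrand2_le (w := w) (fun y hy => h.abs_FF_le hy)
    (fun y hy => h.abs_fB_le hy) k hw
  exact Integrable.mono' ((integrableOn_exp_neg_Ioi P.al1).const_mul _)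
    (P.continuous_integrand2 h.continuous_FF h.continuous_fB k).aestronglyMeasurable
    ((ae_restrict_mem measurableSet_Ioi).mono hle)

/-- Dominated convergence along the joint filter: the majorant is independent of `L` and `N`, and
continuous convergence supplies the pointwise limit. -/
lemma tendsto_H2 (k : ℕ) : Tendsto (fun n : ℕ × ℕ => P.H2 n.1 n.2 k) atTop
    (𝓝 (P.I2inf P.FF P.fB k)) := by
  simp only [← fun L N => (h.hasIntegralIoi_integrand2 L N k).2]
  refine tendsto_integral_filter_of_dominated_convergence _
    (Eventually.of_forall fun n => (P.continuous_integrand2 (P.continuous_FFapprox _)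
      (P.continuous_fBapprox _) k).aestronglyMeasurable)
    (Eventually.of_forall fun n => (ae_restrict_mem measurableSet_Ioi).mono fun w hw =>
      h.norm_integrand2_le (fun y hy => h.abs_FFapprox_le n.1 hy)
        (fun y hy => h.abs_fBapprox_le n.2 hy) k hw)
    ((integrableOn_exp_neg_Ioi P.al1).const_mul _) (ae_of_all _ fun w => ?_)
  have := (P.contConv_integrand2 (h.contConv_FFapprox.reindex (tendsto_fst (g := atTop)))
    (h.contConv_fBapprox.reindex (tendsto_snd (f := atTop))) k).tendsto w
  rwa [prod_atTop_atTop_eq] at this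

end Admissible

end SGFParams

/-! ### Independence and conditioning on one variable -/

section General

variable {α β Ω : Type*} [MeasurableSpace α] [MeasurableSpace β] [MeasurableSpace Ω]
  {ν : Measure Ω}

lemma measureReal_prod_eq_integral (μ : Measure α) [SFinite μ] (η : Measure β)
    [IsFiniteMeasure η] {S : Set (α × β)} (hS : MeasurableSet S) :
    (μ.prod η).real S = ∫ x, η.real (Prod.mk x ⁻¹' S) ∂μ := by
  rw [Measure.real, Measure.prod_apply hS]
  exact (integral_toReal (measurable_measure_prodMk_left hS).aemeasurable
    (ae_of_all _ fun x => measure_lt_top _ _)).symm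

lemma hasLaw_prodMk_of_indepFun {X : Ω → α} {Y : Ω → β} {μ : Measure α} {η : Measure β}
    [IsFiniteMeasure ν] (hX : HasLaw X μ ν) (hY : HasLaw Y η ν) (hXY : IndepFun X Y ν) :
    HasLaw (fun ω => (X ω, Y ω)) (μ.prod η) ν where
  aemeasurable := hX.aemeasurable.prodMk hY.aemeasurable
  map_eq := by
    rw [(indepFun_iff_map_prod_eq_prod_map_map hX.aemeasurable hY.aemeasurable).1 hXY, hX.map_eq,
      hY.map_eq]

/-- Pairing up two jointly independent families yields an independent family. -/
lemma iIndepFun_prodMk_of_sumElim {ι : Type*} [Fintype ι] [IsProbabilityMeasure ν]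
    {X Y : ι → Ω → α} (hX : ∀ i, AEMeasurable (X i) ν) (hY : ∀ i, AEMeasurable (Y i) ν)
    (h : iIndepFun (Sum.elim X Y) ν) : iIndepFun (fun i ω => (X i ω, Y i ω)) ν := by
  have hm : ∀ s, AEMeasurable (Sum.elim X Y s) ν := by
    rintro (i | i)
    · exact hX i
    · exact hY i
  have hp : ∀ s, IsProbabilityMeasure (ν.map (Sum.elim X Y s)) := fun s =>
    Measure.isProbabilityMeasure_map (hm s)
  have hpX : ∀ i, IsProbabilityMeasure (ν.map (X i)) := fun i =>
    Measure.isProbabilityMeasure_map (hX i)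
  have hpY : ∀ i, IsProbabilityMeasure (ν.map (Y i)) := fun i =>
    Measure.isProbabilityMeasure_map (hY i)
  have hpair : ∀ i, ν.map (fun ω => (X i ω, Y i ω)) = (ν.map (X i)).prod (ν.map (Y i)) := by
    intro i
    have : IndepFun (X i) (Y i) ν := h.indepFun (Sum.inl_ne_inr (a := i) (b := i))
    exact (indepFun_iff_map_prod_eq_prod_map_map (hX i) (hY i)).1 this
  rw [iIndepFun_iff_map_fun_eq_pi_map fun i => (hX i).prodMk (hY i)]
  simp only [hpair]
  have hall := (iIndepFun_iff_map_fun_eq_pi_map hm).1 h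
  -- The joint law over `ι ⊕ ι` is a product measure; two measure-preserving rearrangements turn it
  -- into the product over `ι` of the laws of the pairs.
  have e1 := measurePreserving_sumPiEquivProdPi (fun s : ι ⊕ ι => ν.map (Sum.elim X Y s))
  have e2 := (measurePreserving_arrowProdEquivProdArrow α α ι (fun i => ν.map (X i))
    (fun i => ν.map (Y i))).symm
  have e3 := e2.comp e1
  rw [← e3.map_eq, ← hall, AEMeasurable.map_map_of_aemeasurable e3.measurable.aemeasurable
    (aemeasurable_pi_lambda _ hm)]
  rfl

lemma indepFun_none_some {ι : Type*} [Fintype ι]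
    {X : Option ι → Ω → α} (hX : ∀ i, AEMeasurable (X i) ν) (h : iIndepFun X ν) :
    IndepFun (X none) (fun ω i => X (some i) ω) ν := by
  classical
  set T : Finset (Option ι) := Finset.univ.image some with hT
  have := h.indepFun_finset₀ {none} T (by simp [hT]) hX
  exact this.comp
    (φ := fun f : (({none} : Finset (Option ι)) → α) => f ⟨none, by simp⟩)
    (ψ := fun (f : T → α) i => f ⟨some i, by simp [hT]⟩)
    (by fun_prop) (by fun_prop)

/-- Fubini: for fixed `X = w` the event is a box with equal sides under a product measure, so its
probability is an `n`-th power. -/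
lemma measureReal_forall_mem {n : ℕ} [IsProbabilityMeasure ν] {X : Ω → α} {Y : Fin n → Ω → β}
    {μ : Measure α} {η : Measure β} [IsProbabilityMeasure μ] [IsProbabilityMeasure η]
    (hX : HasLaw X μ ν) (hY : ∀ k, HasLaw (Y k) η ν) (hi : iIndepFun Y ν)
    (hXY : IndepFun X (fun ω k => Y k ω) ν) {S : Set (α × β)} (hS : MeasurableSet S) :
    ν.real {ω | ∀ k, (X ω, Y k ω) ∈ S} = ∫ w, η.real (Prod.mk w ⁻¹' S) ^ n ∂μ := by
  have hlaw := hasLaw_prodMk_of_indepFun hX (iIndepFun.hasLaw_pi hY hi) hXY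
  have hT : MeasurableSet {p : α × (Fin n → β) | ∀ k, (p.1, p.2 k) ∈ S} := by
    rw [Set.ofPred_forall]
    refine MeasurableSet.iInter fun k => ?_
    exact hS.preimage (f := fun p : α × (Fin n → β) => (p.1, p.2 k)) (by fun_prop)
  rw [Measure.real, hlaw.measure_eq hT, ← Measure.real, measureReal_prod_eq_integral _ _ hT]
  refine integral_congr_ae (ae_of_all _ fun w => ?_)
  have : Prod.mk w ⁻¹' {p : α × (Fin n → β) | ∀ k, (p.1, p.2 k) ∈ S} =
      Set.univ.pi fun _ => Prod.mk w ⁻¹' S := by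
    ext y
    simp
  simp only [this, Measure.real, Measure.pi_pi, ENNReal.toReal_prod]
  simp

end General

/-! ### Laws of the channel gains -/

lemma measurableSet_ring (R₀ R₁ : ℝ) : MeasurableSet {z : ℂ | R₀ ≤ ‖z‖ ∧ ‖z‖ ≤ R₁} :=
  (measurableSet_le measurable_const measurable_norm).inter
    (measurableSet_le measurable_norm measurable_const)

lemma integral_ring_norm (g : ℝ → ℝ) {R₀ R₁ : ℝ} (h0 : 0 ≤ R₀) (h1 : R₀ ≤ R₁) :
    ∫ z in {z : ℂ | R₀ ≤ ‖z‖ ∧ ‖z‖ ≤ R₁}, g ‖z‖ = 2 * Real.pi * ∫ r in R₀..R₁, g r * r := by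
  have hm := measurableSet_ring R₀ R₁
  have hball : (volume : Measure ℂ).real (Metric.ball 0 1) = Real.pi := by
    simp [Measure.real, Complex.volume_ball]
  have key := integral_fun_norm_addHaar (volume : Measure ℂ) ((Set.Icc R₀ R₁).indicator g)
  rw [Complex.finrank_real_complex, hball] at key
  rw [← integral_indicator hm]
  have : ∀ z : ℂ, {z : ℂ | R₀ ≤ ‖z‖ ∧ ‖z‖ ≤ R₁}.indicator (fun z => g ‖z‖) z =
      (Set.Icc R₀ R₁).indicator g ‖z‖ := fun z => by
    by_cases hz : R₀ ≤ ‖z‖ ∧ ‖z‖ ≤ R₁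
    · rw [Set.indicator_of_mem (by exact hz), Set.indicator_of_mem (by exact hz)]
    · rw [Set.indicator_of_notMem (by exact hz), Set.indicator_of_notMem (by exact hz)]
  simp only [this]
  rw [key, intervalIntegral.integral_of_le h1]
  have hset : ∀ r : ℝ, r ^ (2 - 1) • (Set.Icc R₀ R₁).indicator g r =
      (Set.Icc R₀ R₁).indicator (fun r => g r * r) r := fun r => by
    by_cases hr : r ∈ Set.Icc R₀ R₁ <;> simp [hr, mul_comm]
  simp only [hset]
  rw [integral_indicator measurableSet_Icc, Measure.restrict_restrict measurableSet_Icc]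
  -- The sets differ at most in the inner endpoint, which may be `0`.
  have hae : ((Set.Icc R₀ R₁ ∩ Set.Ioi 0 : Set ℝ)) =ᵐ[volume] (Set.Ioc R₀ R₁ : Set ℝ) := by
    have h2 : (Set.Ioc R₀ R₁ : Set ℝ) = Set.Ioc R₀ R₁ ∩ Set.Ioi 0 :=
      (Set.inter_eq_left.2 fun r hr => h0.trans_lt hr.1).symm
    rw [h2]
    exact Ioc_ae_eq_Icc.symm.inter (ae_eq_refl _)
  rw [setIntegral_congr_set hae]
  simp only [nsmul_eq_mul, smul_eq_mul]
  push_cast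
  ring

lemma integral_uniformRing_norm (g : ℝ → ℝ) {R₀ R₁ : ℝ} (h0 : 0 ≤ R₀) (h1 : R₀ ≤ R₁) :
    ∫ z, g ‖z‖ ∂(uniformRing R₀ R₁) = 2 / (R₁ ^ 2 - R₀ ^ 2) * ∫ r in R₀..R₁, g r * r := by
  have hvol : (volume : Measure ℂ).real {z : ℂ | R₀ ≤ ‖z‖ ∧ ‖z‖ ≤ R₁} =
      Real.pi * (R₁ ^ 2 - R₀ ^ 2) := by
    have := integral_ring_norm (fun _ => 1) h0 h1
    simp only [integral_const, one_mul, integral_id, smul_eq_mul, mul_one] at this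
    rw [measureReal_restrict_apply_univ] at this
    rw [this]
    ring
  rw [uniformRing, ProbabilityTheory.cond, integral_smul_measure,
    integral_ring_norm g h0 h1, ENNReal.toReal_inv, ← Measure.real, hvol,
    smul_eq_mul, mul_inv, div_eq_mul_inv]
  field_simp

/-- Treating the disc as a ring of inner radius `0` lets a single gain law serve GF and GB users. -/
lemma uniformDisc_eq_uniformRing (R : ℝ) : uniformDisc R = uniformRing 0 R := by
  have : Metric.closedBall (0 : ℂ) R = {z : ℂ | 0 ≤ ‖z‖ ∧ ‖z‖ ≤ R} := by
    ext z
    simp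
  rw [uniformDisc, uniformRing, this]

/-- In polar coordinates the density has the radial antiderivative `-exp (-r²)`: the squared modulus
is standard exponential. -/
lemma stdComplexGaussian_real {t : ℝ} (ht : 0 ≤ t) :
    stdComplexGaussian.real {z | ‖z‖ ^ 2 ≤ t} = 1 - Real.exp (-t) := by
  have hset : {z : ℂ | ‖z‖ ^ 2 ≤ t} = {z : ℂ | 0 ≤ ‖z‖ ∧ ‖z‖ ≤ Real.sqrt t} := by
    ext z
    simp [Real.le_sqrt (norm_nonneg z) ht]
  have hball : {z : ℂ | ‖z‖ ^ 2 ≤ t} = Metric.closedBall 0 (Real.sqrt t) := by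
    rw [hset]
    ext z
    simp
  have hc : Continuous fun z : ℂ => Real.exp (-‖z‖ ^ 2) / Real.pi := by fun_prop
  have hm : MeasurableSet {z : ℂ | ‖z‖ ^ 2 ≤ t} := hset ▸ measurableSet_ring _ _
  have hint : IntegrableOn (fun z : ℂ => Real.exp (-‖z‖ ^ 2) / Real.pi) {z : ℂ | ‖z‖ ^ 2 ≤ t} :=
    hball ▸ hc.continuousOn.integrableOn_compact (isCompact_closedBall _ _)
  rw [Measure.real, stdComplexGaussian, withDensity_apply _ hm,
    ← ofReal_integral_eq_lintegral_ofReal hint (ae_of_all _ fun z => by positivity),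
    ENNReal.toReal_ofReal (integral_nonneg fun z => by positivity), hset,
    integral_ring_norm (fun r => Real.exp (-r ^ 2) / Real.pi) le_rfl (Real.sqrt_nonneg t)]
  have hd : ∀ r ∈ Set.uIcc 0 (Real.sqrt t), HasDerivAt (fun r : ℝ => -Real.exp (-r ^ 2))
      (2 * Real.pi * (Real.exp (-r ^ 2) / Real.pi * r)) r := by
    intro r _
    have := ((hasDerivAt_pow 2 r).neg.exp).neg
    refine this.congr_deriv ?_
    have := Real.pi_ne_zero
    simp only [Pi.neg_apply]
    field_simp
    norm_num
    ring
  rw [← intervalIntegral.integral_const_mul,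
    intervalIntegral.integral_eq_sub_of_hasDerivAt hd
      (Continuous.intervalIntegrable (by fun_prop) _ _)]
  rw [Real.sq_sqrt ht]
  simp
  ring

namespace SGFParams

/-- The channel gain as a function of position and fading coefficient. -/
def gainFun (P : SGFParams) (p : ℂ × ℂ) : ℝ :=
  ‖p.2 / ((Real.sqrt (1 + ‖p.1‖ ^ P.a) : ℝ) : ℂ)‖ ^ 2

lemma gainFun_eq (P : SGFParams) (p : ℂ × ℂ) :
    P.gainFun p = ‖p.2‖ ^ 2 / (1 + ‖p.1‖ ^ P.a) := by
  have : 0 ≤ 1 + ‖p.1‖ ^ P.a := by positivity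
  rw [gainFun, norm_div, div_pow, Complex.norm_real, Real.norm_eq_abs, sq_abs, Real.sq_sqrt this]

lemma measurable_gainFun (P : SGFParams) : Measurable P.gainFun := by
  unfold gainFun
  fun_prop

/-- The law of the channel gain of a user with uniform position in a ring. -/
def gainLaw (P : SGFParams) (R₀ R₁ : ℝ) : Measure ℝ :=
  ((uniformRing R₀ R₁).prod stdComplexGaussian).map P.gainFun

/-- Given the position `z`, the gain is at most `y` iff the squared modulus of the fading
coefficient is at most `(1 + ‖z‖ ^ a) * y`; this exponential probability is then averaged over
positions. -/
lemma gainLaw_real_Iic (P : SGFParams) [IsProbabilityMeasure stdComplexGaussian] {R₀ R₁ : ℝ}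
    (h0 : 0 ≤ R₀) (h1 : R₀ ≤ R₁) [IsProbabilityMeasure (uniformRing R₀ R₁)] {y : ℝ} (hy : 0 ≤ y) :
    (P.gainLaw R₀ R₁).real (Set.Iic y) =
      2 / (R₁ ^ 2 - R₀ ^ 2) * ∫ r in R₀..R₁, (1 - Real.exp (-(1 + r ^ P.a) * y)) * r := by
  rw [← integral_uniformRing_norm (fun r => 1 - Real.exp (-(1 + r ^ P.a) * y)) h0 h1, gainLaw,
    Measure.real, Measure.map_apply P.measurable_gainFun measurableSet_Iic, ← Measure.real,
    measureReal_prod_eq_integral _ _ (P.measurable_gainFun measurableSet_Iic)]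
  refine integral_congr_ae (ae_of_all _ fun z => ?_)
  have hpos : 0 < 1 + ‖z‖ ^ P.a := by positivity
  have hset : Prod.mk z ⁻¹' (P.gainFun ⁻¹' Set.Iic y) =
      {q : ℂ | ‖q‖ ^ 2 ≤ (1 + ‖z‖ ^ P.a) * y} := by
    ext q
    simp [gainFun_eq, div_le_iff₀ hpos, mul_comm]
  simp only [hset]
  rw [stdComplexGaussian_real (by positivity), neg_mul]

lemma gainLaw_Iio_zero (P : SGFParams) (R₀ R₁ : ℝ) : P.gainLaw R₀ R₁ (Set.Iio 0) = 0 := by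
  rw [gainLaw, Measure.map_apply P.measurable_gainFun measurableSet_Iio]
  have : P.gainFun ⁻¹' Set.Iio 0 = ∅ := by
    ext p
    simp only [Set.mem_preimage, Set.mem_Iio, Set.mem_empty_iff_false, iff_false, not_lt]
    unfold gainFun
    positivity
  rw [this, measure_empty]

namespace Admissible

variable {P : SGFParams} (h : P.Admissible)
include h

section Laws

variable [IsProbabilityMeasure stdComplexGaussian]

lemma gainLaw_disc_real_Iic [IsProbabilityMeasure (uniformRing 0 P.DF)] {y : ℝ} (hy : 0 ≤ y) :
    (P.gainLaw 0 P.DF).real (Set.Iic y) = P.FF y := by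
  rw [P.gainLaw_real_Iic le_rfl h.DF_pos.le hy, FF]
  simp

lemma gainLaw_ring_real_Iic [IsProbabilityMeasure (uniformRing P.D0 P.D1)] {y : ℝ} (hy : 0 ≤ y) :
    (P.gainLaw P.D0 P.D1).real (Set.Iic y) = P.FB y :=
  P.gainLaw_real_Iic h.D0_pos.le h.D0_lt_D1.le hy

/-- Left continuity of `FF` excludes an atom at `y`; strict and weak inequalities have the same
probability. -/
lemma gainLaw_disc_real_Iio [IsProbabilityMeasure (uniformRing 0 P.DF)] {y : ℝ} (hy : 0 < y) :
    (P.gainLaw 0 P.DF).real (Set.Iio y) = P.FF y := by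
  have : IsProbabilityMeasure (P.gainLaw 0 P.DF) :=
    Measure.isProbabilityMeasure_map P.measurable_gainFun.aemeasurable
  apply le_antisymm
  · rw [← h.gainLaw_disc_real_Iic hy.le]
    exact measureReal_mono Set.Iio_subset_Iic_self
  · have ht : Tendsto P.FF (𝓝[<] y) (𝓝 (P.FF y)) :=
      (h.continuous_FF.tendsto y).mono_left inf_le_left
    refine le_of_tendsto ht ?_
    filter_upwards [Ioo_mem_nhdsLT hy] with z hz
    rw [← h.gainLaw_disc_real_Iic hz.1.le]
    exact measureReal_mono fun t ht => lt_of_le_of_lt ht hz.2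

lemma gainLaw_ring_eq_withDensity [IsProbabilityMeasure (uniformRing P.D0 P.D1)] :
    P.gainLaw P.D0 P.D1 =
      (volume.restrict (Set.Ioi 0)).withDensity fun w => ENNReal.ofReal (P.fB w) := by
  have : IsProbabilityMeasure (P.gainLaw P.D0 P.D1) :=
    Measure.isProbabilityMeasure_map P.measurable_gainFun.aemeasurable
  refine Measure.ext_of_Iic _ _ fun y => ?_
  rw [withDensity_apply _ measurableSet_Iic, Measure.restrict_restrict measurableSet_Iic]
  rcases lt_or_ge y 0 with hy | hy
  · rw [measure_mono_null (Set.Iic_subset_Iio.2 hy) (P.gainLaw_Iio_zero _ _)]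
    have : Set.Iic y ∩ Set.Ioi (0 : ℝ) = ∅ := by
      ext t
      simp only [Set.mem_inter_iff, Set.mem_Iic, Set.mem_Ioi, Set.mem_empty_iff_false, iff_false]
      intro ht
      linarith [ht.1, ht.2]
    simp [this]
  · rw [Set.inter_comm, Set.Ioi_inter_Iic, ← ofReal_integral_eq_lintegral_ofReal
      (h.continuous_fB.integrableOn_Ioc) (ae_of_all _ fun w => h.fB_nonneg w),
      ← intervalIntegral.integral_of_le hy,
      intervalIntegral.integral_eq_sub_of_hasDerivAt (fun w _ => h.hasDerivAt_FB w)
        (h.continuous_fB.intervalIntegrable _ _), P.FB_zero, sub_zero,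
      ← h.gainLaw_ring_real_Iic hy, ofReal_measureReal]

lemma integral_gainLaw_ring [IsProbabilityMeasure (uniformRing P.D0 P.D1)] (g : ℝ → ℝ) :
    ∫ w, g w ∂(P.gainLaw P.D0 P.D1) = ∫ w in Set.Ioi 0, P.fB w * g w := by
  rw [h.gainLaw_ring_eq_withDensity, integral_withDensity_eq_integral_toReal_smul
    (h.continuous_fB.measurable.ennreal_ofReal) (ae_of_all _ fun w => ENNReal.ofReal_lt_top)]
  simp only [ENNReal.toReal_ofReal (h.fB_nonneg _), smul_eq_mul]

/-- Total mass one gives the tail without computing the limit of `FB` at infinity. -/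
lemma integral_Ioi_fB [IsProbabilityMeasure (uniformRing P.D0 P.D1)] {y : ℝ} (hy : 0 ≤ y) :
    ∫ w in Set.Ioi y, P.fB w = 1 - P.FB y := by
  have : IsProbabilityMeasure (P.gainLaw P.D0 P.D1) :=
    Measure.isProbabilityMeasure_map P.measurable_gainFun.aemeasurable
  have htot := h.integral_gainLaw_ring (fun _ => 1)
  simp only [integral_const, probReal_univ, smul_eq_mul, mul_one] at htot
  have hsplit := intervalIntegral.integral_interval_add_Ioi h.integrableOn_fB
    (h.integrableOn_fB.mono_set (Set.Ioi_subset_Ioi hy))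
  rw [intervalIntegral.integral_eq_sub_of_hasDerivAt (fun w _ => h.hasDerivAt_FB w)
        (h.continuous_fB.intervalIntegrable _ _), P.FB_zero] at hsplit
  linarith

end Laws

end Admissible

/-! ### Ordered gains and decomposition of the outage event -/

section Events

variable (P : SGFParams)

/-- Pairs (GB gain, GF gain) for which the GF rate is below target. -/
def userOutage : Set (ℝ × ℝ) :=
  {p | (if max 0 (P.PB * p.1 / P.gamB - 1) < P.PF * p.2
    then Real.logb 2 (1 + P.PF * p.2 / (P.PB * p.1 + 1)) else Real.logb 2 (1 + P.PF * p.2)) < P.RF}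

lemma measurableSet_userOutage : MeasurableSet P.userOutage := by
  refine measurableSet_lt (Measurable.ite (measurableSet_lt (by fun_prop) (by fun_prop)) ?_ ?_)
    measurable_const
  · exact Real.measurable_log.comp (by fun_prop) |>.div_const _
  · exact Real.measurable_log.comp (by fun_prop) |>.div_const _

variable {P} {Ω : Type*} (x ζ : Option (Fin P.K) → Ω → ℂ)

lemma admittedRate_lt_iff (hK : 0 < P.K) (ω : Ω) :
    P.admittedRate x ζ ω < P.RF ↔ ∀ k, P.rate x ζ k ω < P.RF := by
  have : Nonempty (Fin P.K) := ⟨⟨0, hK⟩⟩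
  obtain ⟨k₀, hk₀⟩ := exists_eq_ciSup_of_finite (f := fun k => P.rate x ζ k ω)
  constructor
  · intro hlt k
    exact (le_ciSup (Set.finite_range _).bddAbove k).trans_lt hlt
  · intro hlt
    rw [admittedRate, ← hk₀]
    exact hlt k₀

lemma rate_lt_iff (k : Fin P.K) (ω : Ω) : P.rate x ζ k ω < P.RF ↔
    (P.gain x ζ none ω, P.gain x ζ (some k) ω) ∈ P.userOutage :=
  Iff.rfl

/-- For sorted values, those below the threshold form an initial segment whose length is their
number, and sorting does not change that number. -/
lemma lt_numBelow_iff (hPF : 0 < P.PF) (ω : Ω) (i : Fin P.K) :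
    (i : ℕ) < P.numBelow x ζ ω ↔ P.PF * P.orderedGain x ζ ω i ≤ P.tau0 x ζ ω := by
  have hmono : Monotone fun i => P.PF * P.orderedGain x ζ ω i := fun i j hij =>
    mul_le_mul_of_nonneg_left
      (Tuple.monotone_sort (fun k => P.gain x ζ (some k) ω) hij) hPF.le
  rw [← Tuple.lt_card_le_iff_apply_le_of_monotone hmono]
  have hcard : P.numBelow x ζ ω =
      (Finset.univ.filter fun i => P.PF * P.orderedGain x ζ ω i ≤ P.tau0 x ζ ω).card := by
    refine (Finset.card_equiv (Tuple.sort fun k => P.gain x ζ (some k) ω) fun i => ?_).symm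
    rw [Finset.mem_filter, Finset.mem_filter]
    simp only [Finset.mem_univ, true_and]
    exact Iff.rfl
  rw [hcard]

/-- The count determines the decoding stage of every sorted user, so the two families of rate
conditions say that all rates are below target, up to a permutation. -/
lemma outageEvent_eq (hPF : 0 < P.PF) (k : ℕ) : P.outageEvent x ζ k =
    {ω | P.numBelow x ζ ω = k} ∩ {ω | ∀ j, P.rate x ζ j ω < P.RF} := by
  ext ω
  simp only [outageEvent, Set.mem_ofPred_eq, Set.mem_inter_iff]
  refine and_congr_right fun hk => ?_
  have hsort : ∀ i, P.rate x ζ (Tuple.sort (fun k => P.gain x ζ (some k) ω) i) ω =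
      if P.tau0 x ζ ω < P.PF * P.orderedGain x ζ ω i
      then P.rateFS x ζ (P.orderedGain x ζ ω i) ω else P.rateSS (P.orderedGain x ζ ω i) :=
    fun _ => rfl
  have hperm : (∀ j, P.rate x ζ j ω < P.RF) ↔
      ∀ i, P.rate x ζ (Tuple.sort (fun k => P.gain x ζ (some k) ω) i) ω < P.RF :=
    (Tuple.sort fun k => P.gain x ζ (some k) ω).surjective.forall
  rw [hperm]
  have hlt : ∀ i : Fin P.K, (i : ℕ) < k ↔ P.PF * P.orderedGain x ζ ω i ≤ P.tau0 x ζ ω := by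
    intro i
    rw [← hk]
    exact lt_numBelow_iff x ζ hPF ω i
  constructor
  · rintro ⟨h1, h2⟩ i
    by_cases hi : (i : ℕ) < k
    · have := (hlt i).1 hi
      rw [hsort, if_neg (not_lt.2 this)]
      exact h1 i hi
    · have := lt_of_not_ge (mt (hlt i).2 hi)
      rw [hsort, if_pos this]
      exact h2 i (not_lt.1 hi)
  · intro hr
    constructor
    · intro i hi
      have h1 := hr i
      rw [hsort, if_neg (not_lt.2 ((hlt i).1 hi))] at h1
      exact h1
    · intro i hi
      have h1 := hr i
      rw [hsort, if_pos (lt_of_not_ge (mt (hlt i).2 (not_lt.2 hi)))] at h1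
      exact h1

variable [MeasurableSpace Ω] {ν : Measure Ω}

lemma aemeasurable_gain (hx : ∀ u, AEMeasurable (x u) ν) (hζ : ∀ u, AEMeasurable (ζ u) ν)
    (u : Option (Fin P.K)) : AEMeasurable (P.gain x ζ u) ν := by
  have heq : P.gain x ζ u = P.gainFun ∘ fun ω => (x u ω, ζ u ω) := rfl
  rw [heq]
  exact P.measurable_gainFun.comp_aemeasurable ((hx u).prodMk (hζ u))

lemma aemeasurable_numBelow (hx : ∀ u, AEMeasurable (x u) ν) (hζ : ∀ u, AEMeasurable (ζ u) ν) :
    AEMeasurable (P.numBelow x ζ) ν := by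
  have hN : Measurable fun y : Option (Fin P.K) → ℝ => (Finset.univ.filter fun k : Fin P.K =>
      P.PF * y (some k) ≤ max 0 (P.PB * y none / P.gamB - 1)).card := by
    simp only [Finset.card_filter]
    refine Finset.measurable_sum _ fun k _ => Measurable.ite
      (measurableSet_le (by fun_prop) (by fun_prop)) measurable_const measurable_const
  exact hN.comp_aemeasurable (aemeasurable_pi_lambda _ (aemeasurable_gain x ζ hx hζ))

lemma nullMeasurableSet_forall_rate_lt (hx : ∀ u, AEMeasurable (x u) ν)
    (hζ : ∀ u, AEMeasurable (ζ u) ν) :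
    NullMeasurableSet {ω | ∀ j, P.rate x ζ j ω < P.RF} ν := by
  rw [Set.ofPred_forall]
  refine NullMeasurableSet.iInter fun j => ?_
  exact ((aemeasurable_gain x ζ hx hζ none).prodMk
    (aemeasurable_gain x ζ hx hζ (some j))).nullMeasurable P.measurableSet_userOutage

lemma outageProb_eq_sum [IsProbabilityMeasure ν] (hK : 0 < P.K) (hPF : 0 < P.PF)
    (hx : ∀ u, AEMeasurable (x u) ν) (hζ : ∀ u, AEMeasurable (ζ u) ν) :
    P.outageProb x ζ ν = ∑ k ∈ Finset.range (P.K + 1), ν.real (P.outageEvent x ζ k) := by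
  simp only [outageProb, admittedRate_lt_iff x ζ hK, outageEvent_eq x ζ hPF]
  have hA := nullMeasurableSet_forall_rate_lt x ζ hx hζ
  have hN : ∀ k, NullMeasurableSet {ω | P.numBelow x ζ ω = k} ν := fun k =>
    (aemeasurable_numBelow x ζ hx hζ).nullMeasurable (measurableSet_singleton k)
  simp only [Measure.real]
  rw [← ENNReal.toReal_sum fun k _ => measure_ne_top _ _, ← measure_biUnion_finset₀
    (fun i _ j _ hij => Disjoint.aedisjoint ?_) (fun k _ => (hN k).inter hA)]
  · congr 2
    ext ω
    simp only [Set.mem_iUnion, Set.mem_inter_iff, Set.mem_ofPred_eq, Finset.mem_range, exists_prop]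
    constructor
    · intro hω
      refine ⟨_, ?_, rfl, hω⟩
      have : P.numBelow x ζ ω ≤ P.K := (Finset.card_le_univ _).trans (by simp)
      omega
    · rintro ⟨_, _, _, hω⟩
      exact hω
  · rw [Set.disjoint_left]
    rintro ω ⟨hi, _⟩ ⟨hj, _⟩
    exact hij (hi.symm.trans hj)

end Events

/-! ### Conditional outage probability and the exact formulas -/

/-- Conditional outage probability of a single GF user given the GB gain. -/
def userOutageProb (P : SGFParams) (w : ℝ) : ℝ :=
  (P.gainLaw 0 P.DF).real (Prod.mk w ⁻¹' P.userOutage)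

lemma logb_two_one_add_lt_iff {t R : ℝ} (ht : 0 ≤ t) :
    Real.logb 2 (1 + t) < R ↔ t < (2 : ℝ) ^ R - 1 := by
  rw [Real.logb_lt_iff_lt_rpow one_lt_two (by linarith), lt_sub_iff_add_lt']

lemma gainLaw_real_congr (P : SGFParams) {S T : Set ℝ} (hST : ∀ y, 0 ≤ y → (y ∈ S ↔ y ∈ T)) :
    (P.gainLaw 0 P.DF).real S = (P.gainLaw 0 P.DF).real T := by
  refine measureReal_congr ?_
  have : ∀ᵐ y ∂(P.gainLaw 0 P.DF), 0 ≤ y := by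
    rw [ae_iff]
    convert P.gainLaw_Iio_zero 0 P.DF using 2
    ext y
    simp
  filter_upwards [this] with y hy
  exact propext (hST y hy)

/-- The base of the power is `FF v + (FF u - FF v)`, which collapses to `FF u`; hence the same
integrand as in `I3`. -/
lemma binomSum_integrand1 (P : SGFParams) (w : ℝ) :
    P.binomSum (fun k => P.integrand1 P.FF P.fB k w) =
    P.fB w * P.FF (P.alF * P.PB * w + P.alF) ^ P.K := by
  have := add_pow (P.FF ((P.alB⁻¹ * w - 1) / P.PF))
    (P.FF (P.alF * P.PB * w + P.alF) - P.FF ((P.alB⁻¹ * w - 1) / P.PF)) P.K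
  rw [add_sub_cancel] at this
  rw [this, binomSum, Finset.mul_sum]
  refine Finset.sum_congr rfl fun k _ => ?_
  unfold integrand1
  ring

lemma binomSum_integrand2 (P : SGFParams) (w : ℝ) :
    P.binomSum (fun k => P.integrand2 P.FF P.fB k w) =
    P.fB w * (P.FF P.alF +
      (P.FF (P.alF * P.PB * w + P.alF) - P.FF ((P.alB⁻¹ * w - 1) / P.PF))) ^ P.K := by
  rw [add_pow, binomSum, Finset.mul_sum]
  refine Finset.sum_congr rfl fun k _ => ?_
  unfold integrand2
  ring

namespace Admissible

variable {P : SGFParams} (h : P.Admissible)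
include h

lemma mem_userOutage_iff {w y : ℝ} (hw : 0 ≤ w) (hy : 0 ≤ y) : (w, y) ∈ P.userOutage ↔
    if max 0 (P.alB⁻¹ * w - 1) < P.PF * y then y < P.alF * P.PB * w + P.alF else y < P.alF := by
  have hPF := h.PF_pos
  have hPB := h.PB_pos
  have hw' : 0 < P.PB * w + 1 := by positivity
  have hfrac : P.PB * w / P.gamB = P.alB⁻¹ * w := by
    rw [alB, inv_div]
    ring
  simp only [userOutage, Set.mem_ofPred_eq, hfrac]
  split_ifs with hc
  · rw [logb_two_one_add_lt_iff (by positivity), div_lt_iff₀ hw', alF,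
      show P.gamF / P.PF * P.PB * w + P.gamF / P.PF = P.gamF * (P.PB * w + 1) / P.PF by ring,
      lt_div_iff₀ hPF, mul_comm y]
    rfl
  · rw [logb_two_one_add_lt_iff (by positivity), alF, lt_div_iff₀ hPF, mul_comm y]
    rfl

lemma alF_lt_iff {w : ℝ} : P.alF < (P.alB⁻¹ * w - 1) / P.PF ↔ P.al1 < w := by
  rw [alF, div_lt_div_iff_of_pos_right h.PF_pos, lt_sub_iff_add_lt, inv_mul_eq_div,
    lt_div_iff₀ h.alB_pos, al1, mul_comm]

/-- Clearing denominators leaves a linear inequality whose coefficient `1 - gamB * gamF` decides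
between the two cases of the theorem. -/
lemma snd_threshold_le_iff {w : ℝ} :
    (P.alB⁻¹ * w - 1) / P.PF ≤ P.alF * P.PB * w + P.alF ↔
      P.PB * w * (1 - P.gamB * P.gamF) ≤ P.gamB * (P.gamF + 1) := by
  have hB := h.gamB_pos
  rw [div_le_iff₀ h.PF_pos, alB, inv_div, alF,
    show (P.gamF / P.PF * P.PB * w + P.gamF / P.PF) * P.PF = P.gamF * P.PB * w + P.gamF by
      have := h.PF_pos
      field_simp, sub_le_iff_le_add, div_mul_eq_mul_div, div_le_iff₀ hB]
  constructor <;> intro _ <;> nlinarith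

lemma snd_threshold_le_iff_le_al2 (hlt : P.gamB * P.gamF < 1) {w : ℝ} :
    (P.alB⁻¹ * w - 1) / P.PF ≤ P.alF * P.PB * w + P.alF ↔ w ≤ P.al2 := by
  have hPB := h.PB_pos
  rw [h.snd_threshold_le_iff, al2, alB, le_div_iff₀ (by linarith), div_mul_eq_mul_div,
    le_div_iff₀ hPB]
  constructor <;> intro _ <;> nlinarith

lemma snd_threshold_le (hge : 1 ≤ P.gamB * P.gamF) {w : ℝ} (hw : 0 ≤ w) :
    (P.alB⁻¹ * w - 1) / P.PF ≤ P.alF * P.PB * w + P.alF := by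
  rw [h.snd_threshold_le_iff]
  have h1 := h.gamB_pos
  have h2 := h.gamF_pos
  have h3 := mul_nonneg h.PB_pos.le hw
  have h4 : 0 < P.gamB * (P.gamF + 1) := by positivity
  nlinarith

lemma binomSum_I1 : P.binomSum (P.I1 P.FF P.fB) =
    ∫ w in P.alB..P.al1, P.fB w * P.FF (P.alF * P.PB * w + P.alF) ^ P.K := by
  simp only [← P.binomSum_integrand1, binomSum, I1]
  rw [intervalIntegral.integral_finsetSum fun k _ => ((P.continuous_integrand1 h.continuous_FF
    h.continuous_fB k).intervalIntegrable _ _).const_mul _]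
  simp only [intervalIntegral.integral_const_mul]

lemma binomSum_I2 : P.binomSum (P.I2 P.FF P.fB) =
    ∫ w in P.al1..P.al2, P.fB w * (P.FF P.alF +
      (P.FF (P.alF * P.PB * w + P.alF) - P.FF ((P.alB⁻¹ * w - 1) / P.PF))) ^ P.K := by
  simp only [← P.binomSum_integrand2, binomSum, I2]
  rw [intervalIntegral.integral_finsetSum fun k _ => ((P.continuous_integrand2 h.continuous_FF
    h.continuous_fB k).intervalIntegrable _ _).const_mul _]
  simp only [intervalIntegral.integral_const_mul]

lemma binomSum_I2inf : P.binomSum (P.I2inf P.FF P.fB) =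
    ∫ w in Set.Ioi P.al1, P.fB w * (P.FF P.alF +
      (P.FF (P.alF * P.PB * w + P.alF) - P.FF ((P.alB⁻¹ * w - 1) / P.PF))) ^ P.K := by
  simp only [← P.binomSum_integrand2, binomSum, I2inf]
  rw [integral_finsetSum _ fun k _ => (h.integrableOn_integrand2 k).const_mul _]
  simp only [integral_const_mul]

section Prob

variable [IsProbabilityMeasure stdComplexGaussian] [IsProbabilityMeasure (uniformRing 0 P.DF)]

/-- Below `al1` every second-stage gain is less than `alF`, hence also less than `u`; so at either
stage failure means a gain below `u`. -/
lemma userOutageProb_of_lt_al1 {w : ℝ} (hw : 0 ≤ w) (hw1 : w < P.al1) :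
    P.userOutageProb w = P.FF (P.alF * P.PB * w + P.alF) := by
  have hF := h.alF_pos
  have hPF := h.PF_pos
  have hPB := h.PB_pos
  have huF : P.alF ≤ P.alF * P.PB * w + P.alF := by
    have : 0 ≤ P.alF * P.PB * w := by positivity
    linarith
  rw [← h.gainLaw_disc_real_Iio (by linarith), userOutageProb]
  refine P.gainLaw_real_congr fun y hy => ?_
  rw [Set.mem_preimage, h.mem_userOutage_iff hw hy, Set.mem_Iio]
  split_ifs with hc
  · exact Iff.rfl
  · have hlt : P.PF * y < P.PF * P.alF := by
      refine (not_lt.1 hc).trans_lt (max_lt (by positivity) ?_)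
      have hiff : P.alB⁻¹ * w - 1 < P.gamF ↔ w < P.al1 := by
        rw [sub_lt_iff_lt_add, inv_mul_eq_div, div_lt_iff₀ h.alB_pos, al1, mul_comm]
      rw [alF, mul_div_cancel₀ _ hPF.ne']
      exact hiff.2 hw1
    have hyF := lt_of_mul_lt_mul_left hlt hPF.le
    exact ⟨fun _ => hyF.trans_le huF, fun _ => hyF⟩

lemma userOutageProb_of_al1_lt {w : ℝ} (hw : P.al1 < w) : P.userOutageProb w =
    (P.gainLaw 0 P.DF).real (Set.Iio P.alF) + (P.gainLaw 0 P.DF).real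
      (Set.Ioo ((P.alB⁻¹ * w - 1) / P.PF) (P.alF * P.PB * w + P.alF)) := by
  have : IsProbabilityMeasure (P.gainLaw 0 P.DF) :=
    Measure.isProbabilityMeasure_map P.measurable_gainFun.aemeasurable
  have hF := h.alF_pos
  have hPF := h.PF_pos
  have hPB := h.PB_pos
  have hw0 : 0 ≤ w := (h.al1_pos.trans hw).le
  have hFv := h.alF_lt_iff.2 hw
  rw [← measureReal_union _ measurableSet_Ioo, userOutageProb]
  · refine P.gainLaw_real_congr fun y hy => ?_
    have hv : 0 < P.alB⁻¹ * w - 1 := by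
      have := hF.trans hFv
      rwa [div_pos_iff_of_pos_right hPF] at this
    rw [Set.mem_preimage, h.mem_userOutage_iff hw0 hy, max_eq_right hv.le,
      Set.mem_union, Set.mem_Iio, Set.mem_Ioo]
    have hlt_iff := div_lt_iff₀' (b := P.alB⁻¹ * w - 1) (a := y) hPF
    split_ifs with hc
    · rw [← hlt_iff] at hc
      constructor
      · exact fun hy => Or.inr ⟨hc, hy⟩
      · rintro (hy | hy)
        · linarith
        · exact hy.2
    · rw [← hlt_iff] at hc
      constructor
      · exact Or.inl
      · rintro (hy | hy)
        · exact hy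
        · exact absurd hy.1 hc
  · rw [Set.disjoint_left]
    intro y hy1 hy2
    exact lt_asymm hy1 (hFv.trans hy2.1)

lemma userOutageProb_of_le {w : ℝ} (hw : P.al1 < w)
    (hle : (P.alB⁻¹ * w - 1) / P.PF ≤ P.alF * P.PB * w + P.alF) :
    P.userOutageProb w = P.FF P.alF +
      (P.FF (P.alF * P.PB * w + P.alF) - P.FF ((P.alB⁻¹ * w - 1) / P.PF)) := by
  have : IsProbabilityMeasure (P.gainLaw 0 P.DF) :=
    Measure.isProbabilityMeasure_map P.measurable_gainFun.aemeasurable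
  have hv := h.alF_pos.trans (h.alF_lt_iff.2 hw)
  rw [h.userOutageProb_of_al1_lt hw, h.gainLaw_disc_real_Iio h.alF_pos,
    ← h.gainLaw_disc_real_Iio (hv.trans_le hle), ← h.gainLaw_disc_real_Iic hv.le]
  -- Removing `Iic v` from `Iio u` needs `v < u`; at equality the open interval is empty and the
  -- difference vanishes.
  rcases hle.eq_or_lt with heq | hlt
  · rw [heq, Set.Ioo_self, measureReal_empty, h.gainLaw_disc_real_Iic (hv.trans_le hle).le,
      h.gainLaw_disc_real_Iio (hv.trans_le hle), sub_self]
  · rw [← measureReal_sdiff (Set.Iic_subset_Iio.2 hlt) measurableSet_Iic, Set.Iio_sdiff_Iic]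

lemma userOutageProb_of_ge {w : ℝ} (hw : P.al1 < w)
    (hle : P.alF * P.PB * w + P.alF ≤ (P.alB⁻¹ * w - 1) / P.PF) :
    P.userOutageProb w = P.FF P.alF := by
  rw [h.userOutageProb_of_al1_lt hw, h.gainLaw_disc_real_Iio h.alF_pos,
    Set.Ioo_eq_empty_of_le hle, measureReal_empty, add_zero]

lemma integrableOn_fB_mul_userOutageProb_pow :
    IntegrableOn (fun w => P.fB w * P.userOutageProb w ^ P.K) (Set.Ioi 0) := by
  have : IsProbabilityMeasure (P.gainLaw 0 P.DF) :=
    Measure.isProbabilityMeasure_map P.measurable_gainFun.aemeasurable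
  have hm : Measurable P.userOutageProb :=
    (measurable_measure_prodMk_left P.measurableSet_userOutage).ennreal_toReal
  refine Integrable.mono' h.integrableOn_fB
    (h.continuous_fB.measurable.mul (hm.pow_const _)).aestronglyMeasurable (ae_of_all _ fun w => ?_)
  have h0 : 0 ≤ P.userOutageProb w := measureReal_nonneg
  rw [Real.norm_of_nonneg (mul_nonneg (h.fB_nonneg w) (pow_nonneg h0 _))]
  exact mul_le_of_le_one_right (h.fB_nonneg w) (pow_le_one₀ h0 measureReal_le_one)

lemma integral_Ioi_zero_eq :
    ∫ w in Set.Ioi 0, P.fB w * P.userOutageProb w ^ P.K =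
      P.binomSum (P.I1 P.FF P.fB) + P.I3 P.FF P.fB +
        ∫ w in Set.Ioi P.al1, P.fB w * P.userOutageProb w ^ P.K := by
  have hint := h.integrableOn_fB_mul_userOutageProb_pow
  rw [← intervalIntegral.integral_interval_add_Ioi hint
    (hint.mono_set (Set.Ioi_subset_Ioi h.al1_pos.le)), h.binomSum_I1, I3,
    add_comm (∫ w in P.alB..P.al1, _)]
  have hc : Continuous fun w => P.fB w * P.FF (P.alF * P.PB * w + P.alF) ^ P.K := by
    have h1 := h.continuous_FF
    have h2 := h.continuous_fB
    fun_prop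
  simp only [integrand3]
  rw [intervalIntegral.integral_add_adjacent_intervals (hc.intervalIntegrable _ _)
    (hc.intervalIntegrable _ _)]
  congr 1
  -- Endpoints are dropped because the formula for the conditional probability is available only for
  -- `w < al1`.
  rw [intervalIntegral.integral_of_le h.al1_pos.le, intervalIntegral.integral_of_le h.al1_pos.le,
    integral_Ioc_eq_integral_Ioo, integral_Ioc_eq_integral_Ioo]
  refine setIntegral_congr_fun measurableSet_Ioo fun w hw => ?_
  simp only [h.userOutageProb_of_lt_al1 hw.1.le hw.2]

lemma integral_Ioi_al1_of_one_le (hge : 1 ≤ P.gamB * P.gamF) :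
    ∫ w in Set.Ioi P.al1, P.fB w * P.userOutageProb w ^ P.K =
      P.binomSum (P.I2inf P.FF P.fB) := by
  rw [h.binomSum_I2inf]
  refine setIntegral_congr_fun measurableSet_Ioi fun w hw => ?_
  have hw' : P.al1 < w := hw
  simp only [h.userOutageProb_of_le hw' (h.snd_threshold_le hge (h.al1_pos.trans hw').le)]

lemma integral_Ioi_al1_of_lt_one [IsProbabilityMeasure (uniformRing P.D0 P.D1)]
    (hlt : P.gamB * P.gamF < 1) :
    ∫ w in Set.Ioi P.al1, P.fB w * P.userOutageProb w ^ P.K =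
      P.binomSum (P.I2 P.FF P.fB) + P.I4 P.FF P.FB := by
  have h12 := h.al1_lt_al2 hlt
  have hint := h.integrableOn_fB_mul_userOutageProb_pow
  rw [← intervalIntegral.integral_interval_add_Ioi
    (hint.mono_set (Set.Ioi_subset_Ioi h.al1_pos.le))
    (hint.mono_set (Set.Ioi_subset_Ioi (h.al1_pos.trans h12).le)), h.binomSum_I2, I4]
  congr 1
  · rw [intervalIntegral.integral_of_le h12.le, intervalIntegral.integral_of_le h12.le]
    refine setIntegral_congr_fun measurableSet_Ioc fun w hw => ?_
    simp only [h.userOutageProb_of_le hw.1 ((h.snd_threshold_le_iff_le_al2 hlt).2 hw.2)]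
  · rw [← h.integral_Ioi_fB (h.al1_pos.trans h12).le, ← integral_mul_const]
    refine setIntegral_congr_fun measurableSet_Ioi fun w hw => ?_
    have hw' : P.al2 < w := hw
    have hle := (not_le.1 (mt (h.snd_threshold_le_iff_le_al2 hlt).1 (not_le.2 hw'))).le
    simp only [h.userOutageProb_of_ge (h12.trans hw') hle]

end Prob

end Admissible

end SGFParams

end

/-! ### Assembly of the exact formulas and the joint limits -/

theorem theorem1 (P : SGFParams) (hK : 2 ≤ P.K) (hDF : 0 < P.DF) (hD0 : 0 < P.D0)
    (hD1 : P.D0 < P.D1) (ha : 0 < P.a) (hPF : 0 < P.PF) (hPB : 0 < P.PB)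
    (hRF : 0 < P.RF) (hRB : 0 < P.RB)
    {Ω : Type*} [MeasurableSpace Ω] (ν : Measure Ω) [IsProbabilityMeasure ν]
    (x ζ : Option (Fin P.K) → Ω → ℂ)
    (hxF : ∀ k : Fin P.K, HasLaw (x (some k)) (uniformDisc P.DF) ν)
    (hxB : HasLaw (x none) (uniformRing P.D0 P.D1) ν)
    (hζ : ∀ u, HasLaw (ζ u) stdComplexGaussian ν)
    (hind : iIndepFun (Sum.elim x ζ) ν) :
    -- `FF`, `FB`, `fB` are the CDFs and the density of the unordered gains
    (∀ (k : Fin P.K) (y : ℝ), 0 ≤ y → ν.real {ω | P.gain x ζ (some k) ω ≤ y} = P.FF y) ∧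
    (∀ y : ℝ, 0 ≤ y →
      ν.real {ω | P.gain x ζ none ω ≤ y} = P.FB y ∧ HasDerivAt P.FB (P.fB y) y) ∧
    -- the outage probability in terms of the ordered gains
    P.outageProb x ζ ν =
      ∑ k ∈ Finset.range (P.K + 1), ν.real (P.outageEvent x ζ k) ∧
    -- the terms common to both cases
    (∀ k ≤ P.K, Tendsto
      (fun n : ℕ × ℕ × ℕ => P.G1 (P.FFapprox n.2.1) (P.fBapprox n.2.2) n.1 k)
      atTop (𝓝 (P.I1 P.FF P.fB k))) ∧
    Tendsto (fun n : ℕ × ℕ × ℕ => P.G3 (P.FFapprox n.2.1) (P.fBapprox n.2.2) n.1)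
      atTop (𝓝 (P.I3 P.FF P.fB)) ∧
    -- the case `γ_B γ_F < 1`
    (P.gamB * P.gamF < 1 →
      P.outageProb x ζ ν =
        P.binomSum (P.I1 P.FF P.fB) + P.binomSum (P.I2 P.FF P.fB)
          + P.I3 P.FF P.fB + P.I4 P.FF P.FB ∧
      (∀ k ≤ P.K, Tendsto
        (fun n : ℕ × ℕ × ℕ => P.G2 (P.FFapprox n.2.1) (P.fBapprox n.2.2) n.1 k)
        atTop (𝓝 (P.I2 P.FF P.fB k))) ∧
      Tendsto (fun n : ℕ × ℕ => P.I4 (P.FFapprox n.1) (P.FBapprox n.2))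
        atTop (𝓝 (P.I4 P.FF P.FB)) ∧
      Tendsto (fun n : ℕ × ℕ × ℕ × ℕ × ℕ =>
          P.approxLT n.1 n.2.1 n.2.2.1 n.2.2.2.1 n.2.2.2.2)
        atTop (𝓝 (P.outageProb x ζ ν))) ∧
    -- the case `1 ≤ γ_B γ_F`
    (1 ≤ P.gamB * P.gamF →
      (∀ k ≤ P.K, IntegrableOn (P.integrand2 P.FF P.fB k) (Set.Ioi P.al1)) ∧
      P.outageProb x ζ ν =
        P.binomSum (P.I1 P.FF P.fB) + P.binomSum (P.I2inf P.FF P.fB) + P.I3 P.FF P.fB ∧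
      (∀ k ≤ P.K, ∀ L N : ℕ, 1 ≤ L → 1 ≤ N →
        IntegrableOn (P.integrand2 (P.FFapprox L) (P.fBapprox N) k) (Set.Ioi P.al1) ∧
        P.I2inf (P.FFapprox L) (P.fBapprox N) k = P.H2 L N k) ∧
      (∀ k ≤ P.K, Tendsto (fun n : ℕ × ℕ => P.H2 n.1 n.2 k)
        atTop (𝓝 (P.I2inf P.FF P.fB k))) ∧
      Tendsto (fun n : ℕ × ℕ × ℕ × ℕ => P.approxGE n.1 n.2.1 n.2.2.1 n.2.2.2)
        atTop (𝓝 (P.outageProb x ζ ν))) := by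
  have h : P.Admissible := ⟨hDF, hD0, hD1, ha, hPF, hPB, hRF, hRB⟩
  have hK0 : 0 < P.K := by omega
  have hζm : ∀ u, AEMeasurable (ζ u) ν := fun u => (hζ u).aemeasurable
  have hxm : ∀ u, AEMeasurable (x u) ν := by
    rintro (_ | k)
    · exact hxB.aemeasurable
    · exact (hxF k).aemeasurable
  simp only [uniformDisc_eq_uniformRing] at hxF
  -- Being laws of random variables, the three reference measures have mass one; no normalising
  -- integral is needed.
  have hpG : IsProbabilityMeasure stdComplexGaussian := by
    rw [← (hζ none).map_eq]
    exact Measure.isProbabilityMeasure_map (hζm none)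
  have hpR : IsProbabilityMeasure (uniformRing P.D0 P.D1) := by
    rw [← hxB.map_eq]
    exact Measure.isProbabilityMeasure_map (hxm none)
  have hpD : IsProbabilityMeasure (uniformRing 0 P.DF) := by
    rw [← (hxF ⟨0, hK0⟩).map_eq]
    exact Measure.isProbabilityMeasure_map (hxm _)
  have hgm := SGFParams.aemeasurable_gain x ζ hxm hζm
  have hpF : IsProbabilityMeasure (P.gainLaw 0 P.DF) :=
    Measure.isProbabilityMeasure_map P.measurable_gainFun.aemeasurable
  have hpB : IsProbabilityMeasure (P.gainLaw P.D0 P.D1) :=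
    Measure.isProbabilityMeasure_map P.measurable_gainFun.aemeasurable
  have hgain : ∀ u, P.gain x ζ u = P.gainFun ∘ fun ω => (x u ω, ζ u ω) := fun _ => rfl
  have hgi : iIndepFun (fun u => P.gain x ζ u) ν :=
    (iIndepFun_prodMk_of_sumElim hxm hζm hind).comp (fun _ => P.gainFun)
      fun _ => P.measurable_gainFun
  have hlaw : ∀ u (R₀ R₁ : ℝ), HasLaw (x u) (uniformRing R₀ R₁) ν →
      HasLaw (P.gain x ζ u) (P.gainLaw R₀ R₁) ν := by
    intro u R₀ R₁ hu
    have hxζ : IndepFun (x u) (ζ u) ν := hind.indepFun (Sum.inl_ne_inr (a := u) (b := u))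
    refine ⟨hgm u, ?_⟩
    rw [hgain, ← AEMeasurable.map_map_of_aemeasurable P.measurable_gainFun.aemeasurable
      ((hxm u).prodMk (hζm u)), (hasLaw_prodMk_of_indepFun hu (hζ u) hxζ).map_eq,
      SGFParams.gainLaw]
  have hlawF := fun k => hlaw (some k) _ _ (hxF k)
  have hlawB := hlaw none _ _ hxB
  have hout : P.outageProb x ζ ν =
      ∫ w in Set.Ioi 0, P.fB w * P.userOutageProb w ^ P.K := by
    rw [← h.integral_gainLaw_ring]
    simp only [SGFParams.outageProb, SGFParams.admittedRate_lt_iff x ζ hK0, SGFParams.rate_lt_iff]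
    exact measureReal_forall_mem hlawB hlawF (hgi.precomp (Option.some_injective _))
      (indepFun_none_some hgm hgi) P.measurableSet_userOutage
  rw [h.integral_Ioi_zero_eq] at hout
  have hbinom : ∀ {ι : Type} {l : Filter ι} {u : ι → ℕ → ℝ} {v : ℕ → ℝ},
      (∀ k ≤ P.K, Tendsto (fun i => u i k) l (𝓝 (v k))) →
      Tendsto (fun i => P.binomSum (u i)) l (𝓝 (P.binomSum v)) := fun huv =>
    tendsto_finsetSum _ fun k hk =>
      (huv k (Nat.lt_succ_iff.1 (Finset.mem_range.1 hk))).const_mul _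
  refine ⟨fun k y hy => ?_, fun y hy => ⟨?_, h.hasDerivAt_FB y⟩,
    SGFParams.outageProb_eq_sum x ζ hK0 hPF hxm hζm, fun k _ => h.tendsto_G1 k, h.tendsto_G3,
    fun hlt => ?_, fun hge => ?_⟩
  · rw [← h.gainLaw_disc_real_Iic hy]
    exact congrArg ENNReal.toReal ((hlawF k).measure_eq measurableSet_Iic)
  · rw [← h.gainLaw_ring_real_Iic hy]
    exact congrArg ENNReal.toReal (hlawB.measure_eq measurableSet_Iic)
  · rw [h.integral_Ioi_al1_of_lt_one hlt] at hout
    have heq : P.outageProb x ζ ν = P.binomSum (P.I1 P.FF P.fB) + P.binomSum (P.I2 P.FF P.fB)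
          + P.I3 P.FF P.fB + P.I4 P.FF P.FB := by
      rw [hout]
      ring
    refine ⟨heq, fun k _ => h.tendsto_G2 hlt k, h.tendsto_I4, ?_⟩
    rw [heq]
    -- As a product filter, `atTop` projects onto the orders each term uses; all terms share the
    -- same `L` and `N`.
    simp only [← prod_atTop_atTop_eq]
    have hM := tendsto_fst.comp (tendsto_snd.comp (tendsto_snd (f := (atTop : Filter ℕ))
      (g := (atTop : Filter ℕ) ×ˢ (atTop : Filter ℕ) ×ˢ (atTop : Filter ℕ) ×ˢ
        (atTop : Filter ℕ))))
    have hI := tendsto_fst (f := (atTop : Filter ℕ))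
      (g := (atTop : Filter ℕ) ×ˢ (atTop : Filter ℕ) ×ˢ (atTop : Filter ℕ) ×ˢ
        (atTop : Filter ℕ))
    have hJ := tendsto_fst.comp (tendsto_snd (f := (atTop : Filter ℕ))
      (g := (atTop : Filter ℕ) ×ˢ (atTop : Filter ℕ) ×ˢ (atTop : Filter ℕ) ×ˢ
        (atTop : Filter ℕ)))
    have hLN := tendsto_snd.comp (tendsto_snd.comp (tendsto_snd (f := (atTop : Filter ℕ))
      (g := (atTop : Filter ℕ) ×ˢ (atTop : Filter ℕ) ×ˢ (atTop : Filter ℕ) ×ˢ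
        (atTop : Filter ℕ))))
    have t1 := hbinom fun k _ => h.tendsto_G1 k
    have t2 := hbinom fun k _ => h.tendsto_G2 hlt k
    have t3 := h.tendsto_G3
    have t4 := h.tendsto_I4
    simp only [← prod_atTop_atTop_eq] at t1 t2 t3 t4
    exact (((t1.comp (hI.prodMk hLN)).add (t2.comp (hJ.prodMk hLN))).add
      (t3.comp (hM.prodMk hLN))).add (t4.comp hLN)
  · rw [h.integral_Ioi_al1_of_one_le hge] at hout
    have heq : P.outageProb x ζ ν =
        P.binomSum (P.I1 P.FF P.fB) + P.binomSum (P.I2inf P.FF P.fB) + P.I3 P.FF P.fB := by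
      rw [hout]
      ring
    refine ⟨fun k _ => h.integrableOn_integrand2 k, heq,
      fun k _ L N _ _ => h.hasIntegralIoi_integrand2 L N k, fun k _ => h.tendsto_H2 k, ?_⟩
    rw [heq]
    simp only [← prod_atTop_atTop_eq]
    have hI := tendsto_fst (f := (atTop : Filter ℕ))
      (g := (atTop : Filter ℕ) ×ˢ (atTop : Filter ℕ) ×ˢ (atTop : Filter ℕ))
    have hM := tendsto_fst.comp (tendsto_snd (f := (atTop : Filter ℕ))
      (g := (atTop : Filter ℕ) ×ˢ (atTop : Filter ℕ) ×ˢ (atTop : Filter ℕ)))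
    have hLN := tendsto_snd.comp (tendsto_snd (f := (atTop : Filter ℕ))
      (g := (atTop : Filter ℕ) ×ˢ (atTop : Filter ℕ) ×ˢ (atTop : Filter ℕ)))
    have t1 := hbinom fun k _ => h.tendsto_G1 k
    have t2 := hbinom fun k _ => h.tendsto_H2 k
    have t3 := h.tendsto_G3
    simp only [← prod_atTop_atTop_eq] at t1 t2 t3
    exact ((t1.comp (hI.prodMk hLN)).add (t2.comp hLN)).add (t3.comp (hM.prodMk hLN))
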